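/- A \emph{flow} on a compact metrizable space $X$ is a continuous map $\mathbb{R}\times X\to X$, $(t,x)\mapsto\phi_t(x)$, with $\phi_0=\mathrm{id}$ and $\phi_{s+t}=\phi_s\circ\phi_t$ for all $s,t\in\mathbb R$. Two flows $(X,(\phi_t))$ and $(Y,(\psi_t))$ are \emph{weakly equivalent} if there is a homeomorphism $\pi:X\to Y$ that maps orbits of $(\phi_t)$ onto orbits of $(\psi_t)$ preserving the time-orientation of each orbit, i.e. for every $x\in X$ there is an increasing bijection $\theta:\mathbb R\to\mathbb R$ with $\theta(0)=0$ and $\pi(\phi_t(x))=\psi_{\theta(t)}(\pi(x))$ for all $t\in\mathbb R$. For a compatible metric $d$ on $X$ and $r\ge 0$ put $d_{[0,r]}(x,x')=\max_{0\le t\le r}d(\phi_t(x),\phi_t(x'))$. For $\epsilon>0$ let $\mathrm{part}_\epsilon(X,d_{[0,r]})$ be the smallest cardinality of a set $B$ such that there is a map of sets $f:X\to B$ for which $f(x)=f(x')$ implies $d_{[0,r]}(x,x')\le\epsilon$, and let $\mathrm{Widim}_\epsilon(X,d_{[0,r]})$ be the smallest Lebesgue covering dimension of a compact metrizable space $P$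 such that there is a continuous map $f:X\to P$ for which $f(x)=f(x')$ implies $d_{[0,r]}(x,x')\le\epsilon$. The topological entropy and the mean dimension of the flow are $$\mathrm{h}_{\mathrm{top}}(X,(\phi_t))=\lim_{\epsilon\to0}\lim_{r\to+\infty}\frac{\log\mathrm{part}_\epsilon(X,d_{[0,r]})}{r},\qquad \mathrm{mdim}(X,(\phi_t))=\lim_{\epsilon\to0}\lim_{r\to+\infty}\frac{\mathrm{Widim}_\epsilon(X,d_{[0,r]})}{r}$$ (the limits exist in $[0,+\infty]$ and do not depend on the choice of $d$). \textbf{Theorem.} There exists a pair of weakly equivalent flows $(X,(\phi_t))$ and $(Y,(\psi_t))$ on compact metrizable spaces, both having fixed points, such that $\mathrm{mdim}(X,(\phi_t))=+\infty$ and $\mathrm{h}_{\mathrm{top}}(Y,(\psi_t))=0$. -/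

import Mathlib

open Filter Topology Set
open scoped ENNReal

noncomputable section

namespace FlowComplexity

/-! A flow on `X` is Mathlib's `Flow ℝ X`: a jointly continuous action of `(ℝ, +)` on `X`. -/

/-- The flows `φ` on `X` and `ψ` on `Y` are weakly equivalent if some homeomorphism `π : X ≃ₜ Y`
maps every orbit of `φ` onto an orbit of `ψ`, preserving the time-orientation: along the orbit of
`x` the two times are related by an increasing bijection `θ` of `ℝ` which fixes `0`. -/
def WeaklyEquivalent {X Y : Type*} [TopologicalSpace X] [TopologicalSpace Y]
    (φ : Flow ℝ X) (ψ : Flow ℝ Y) : Prop :=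
  ∃ π : X ≃ₜ Y, ∀ x : X, ∃ θ : ℝ ≃o ℝ, θ 0 = 0 ∧ ∀ t : ℝ, π (φ t x) = ψ (θ t) (π x)

/-- A weak equivalence maps orbits onto orbits. -/
theorem WeaklyEquivalent.image_orbit {X Y : Type*} [TopologicalSpace X] [TopologicalSpace Y]
    {φ : Flow ℝ X} {ψ : Flow ℝ Y} (h : WeaklyEquivalent φ ψ) :
    ∃ π : X ≃ₜ Y, ∀ x : X, π '' φ.orbit x = ψ.orbit (π x) := by
  obtain ⟨π, hπ⟩ := h
  refine ⟨π, fun x => ?_⟩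
  obtain ⟨θ, -, hθ⟩ := hπ x
  simp only [Flow.orbit_eq_range]
  ext y
  constructor
  · rintro ⟨_, ⟨t, rfl⟩, rfl⟩
    exact ⟨θ t, (hθ t).symm⟩
  · rintro ⟨s, rfl⟩
    refine ⟨φ (θ.symm s) x, ⟨_, rfl⟩, ?_⟩
    rw [hθ, OrderIso.apply_symm_apply]

/-- `x` is a fixed point of the flow `φ`. -/
def IsFixedPoint {X : Type*} [TopologicalSpace X] (φ : Flow ℝ X) (x : X) : Prop :=
  ∀ t : ℝ, φ t x = x

/-- The Bowen metric `max_{t ∈ F} d(φ_t x, φ_t y)` generated by a nonempty compact `F ⊆ ℝ`. -/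
def bowenDist {X : Type*} [MetricSpace X] (φ : Flow ℝ X) (F : Set ℝ) (x y : X) : ℝ :=
  ⨆ t : F, dist (φ t x) (φ t y)

/-- `part_ε(X, d)`: the smallest cardinality of a set `B` with a map `f : X → B` (of sets) such
that `f x = f y` implies `d x y ≤ ε` (and `⊤` if no finite `B` works). -/
def partNumber {X : Type*} (d : X → X → ℝ) (ε : ℝ) : ℕ∞ :=
  sInf {m : ℕ∞ | ∃ n : ℕ, m = n ∧ ∃ f : X → Fin n, ∀ x y : X, f x = f y → d x y ≤ ε}

/-- Topological entropy of a flow on a compact metric space,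
`lim_{ε → 0} lim_{r → ∞} log part_ε(X, d_{[0,r]}) / r`. The inner limit exists by subadditivity
and so equals the `limsup`; the outer limit is monotone in `ε` and so equals the supremum. -/
def topEntropy {X : Type*} [MetricSpace X] [CompactSpace X] (φ : Flow ℝ X) : EReal :=
  ⨆ (ε : ℝ) (_ : 0 < ε), limsup
    (fun r : ℝ => ENNReal.log (partNumber (bowenDist φ (Icc 0 r)) ε : ℝ≥0∞) / (r : EReal)) atTop

/-- The Lebesgue covering dimension of `P` is at most `n`: every finite open cover has an open
refinement covering `P` such that every point lies in at most `n + 1` of its members. -/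
def CoveringDimLE (P : Type*) [TopologicalSpace P] (n : ℕ) : Prop :=
  ∀ 𝒰 : Set (Set P), 𝒰.Finite → (∀ U ∈ 𝒰, IsOpen U) → ⋃₀ 𝒰 = univ →
    ∃ 𝒱 : Set (Set P), (∀ V ∈ 𝒱, IsOpen V) ∧ ⋃₀ 𝒱 = univ ∧ (∀ V ∈ 𝒱, ∃ U ∈ 𝒰, V ⊆ U) ∧
      ∀ p : P, {V ∈ 𝒱 | p ∈ V}.encard ≤ n + 1

/-- Lebesgue covering dimension of a nonempty space (the empty space gets the value `0`). -/
def coveringDim (P : Type*) [TopologicalSpace P] : ℕ∞ :=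
  sInf {m : ℕ∞ | ∃ n : ℕ, m = n ∧ CoveringDimLE P n}

/-- `Widim_ε(X, d)`: the minimum of `dim P` over the compact metrizable spaces `P` that admit a
continuous map `f : X → P` such that `f x = f y` implies `d x y ≤ ε`. Every compact metrizable
space is homeomorphic to one in `Type`, so it is enough that `P` ranges over `Type`. -/
def widim {X : Type*} [TopologicalSpace X] (d : X → X → ℝ) (ε : ℝ) : ℕ∞ :=
  sInf {m : ℕ∞ | ∃ (P : Type) (_ : TopologicalSpace P),
    CompactSpace P ∧ TopologicalSpace.MetrizableSpace P ∧ m = coveringDim P ∧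
      ∃ f : X → P, Continuous f ∧ ∀ x y : X, f x = f y → d x y ≤ ε}

/-- Mean dimension of a flow on a compact metric space,
`lim_{ε → 0} lim_{r → ∞} Widim_ε(X, d_{[0,r]}) / r`. Again the inner limit exists by subadditivity
and so equals the `limsup`, and the outer limit equals the supremum. -/
def meanDim {X : Type*} [MetricSpace X] [CompactSpace X] (φ : Flow ℝ X) : ℝ≥0∞ :=
  ⨆ (ε : ℝ) (_ : 0 < ε), limsup
    (fun r : ℝ => (widim (bowenDist φ (Icc 0 r)) ε : ℝ≥0∞) / ENNReal.ofReal r) atTop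

end FlowComplexity

end

/-! Both flows live on the same compact space, and the second is a time change of the first. The
first is the shift on `1`-Lipschitz functions `ℝ → [0, 1]` which, for every `n`, vanish on intervals
of length `n + 1` with bounded waiting time. These gaps make every orbit return to each neighborhood
of the zero function within a time that does not depend on the orbit, yet they can be arranged to
take up less than half of the line.

Infinite mean dimension: for each `q`, the unit intervals outside the gaps hold at least `q * 8 ^ m`
independent bumps over `[0, 8 ^ m]`, of a height that depends only on `q`. This is a cube in the
space whose opposite faces stay a fixed distance apart in the Bowen metric. Lebesgue's covering
theorem, derived from Kuhn's parity argument, then bounds `widim` from below by the dimension of the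
cube (`le_widim`, `exists_le_widim_shiftFlow`).

Zero entropy: let a clock run at a rate `w ≥ 1` that blows up fast enough at the fixed point. By
uniform recurrence the clock outruns every linear function of the original time, so in clock time
orbits spend almost all of their time near the fixed point (`exists_slow_rate`,
`mostlyNear_slowFlow`). Such orbits are described by mostly blank codes, whose number grows
subexponentially (`topEntropy_eq_zero`). The time change extends continuously to the fixed point
because `w ≥ 1` means that clock time `s` never exceeds original time `|s|` of motion. -/

/-! ### Kuhn's cubical Sperner lemma -/

namespace Kuhn

theorem even_card_of_involution {α : Type*} (s : Finset α) (g : α → α)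
    (hmem : ∀ a ∈ s, g a ∈ s) (hinv : ∀ a ∈ s, g (g a) = a) (hne : ∀ a ∈ s, g a ≠ a) :
    Even s.card := by
  have h : ∑ _a ∈ s, (1 : ZMod 2) = 0 :=
    Finset.sum_involution (fun a _ => g a) (fun _ _ => by decide)
      (fun a ha _ => hne a ha) hmem hinv
  rw [Finset.sum_const, nsmul_eq_mul, mul_one] at h
  exact (ZMod.natCast_eq_zero_iff_even).1 h

/-- Among the indices `0, …, N`, the number of `j` such that the labels of the others exhaust
`0, …, N - 1` is odd exactly if all labels `0, …, N` occur. -/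
theorem card_doors_mod_two (N : ℕ) (f : ℕ → ℕ) (hf : ∀ j ≤ N, f j ≤ N)
    [DecidablePred fun j => ∀ m < N, ∃ i ≤ N, i ≠ j ∧ f i = m]
    [Decidable (∀ m ≤ N, ∃ i ≤ N, f i = m)] :
    ((Finset.range (N + 1)).filter fun j => ∀ m < N, ∃ i ≤ N, i ≠ j ∧ f i = m).card % 2
      = if ∀ m ≤ N, ∃ i ≤ N, f i = m then 1 else 0 := by
  split_ifs with hfull
  · have hinj : Set.InjOn f (Finset.range (N + 1)) := by
      apply Finset.injOn_of_surjOn_of_card_le (t := Finset.range (N + 1)) f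
      · intro i hi
        have := hf i (by simpa [Nat.lt_succ_iff] using hi)
        simpa [Nat.lt_succ_iff] using this
      · intro m hm
        obtain ⟨i, hi, rfl⟩ := hfull m (by simpa [Nat.lt_succ_iff] using hm)
        exact ⟨i, by simpa [Nat.lt_succ_iff] using hi, rfl⟩
      · simp
    obtain ⟨j, hj, hjN⟩ := hfull N le_rfl
    have : ((Finset.range (N + 1)).filter fun j => ∀ m < N, ∃ i ≤ N, i ≠ j ∧ f i = m) = {j} := by
      ext j'
      simp only [Finset.mem_filter, Finset.mem_range, Finset.mem_singleton]
      constructor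
      · rintro ⟨hj', h⟩
        have hN : f j' = N := by
          by_contra hne
          obtain ⟨i, hi, hij, hfi⟩ := h (f j') (lt_of_le_of_ne (hf j' (by omega)) hne)
          exact hij (hinj (by simp; omega) (by simp; omega) hfi)
        exact hinj (by simp; omega) (by simp; omega) (hN.trans hjN.symm)
      · rintro rfl
        refine ⟨by omega, fun m hm => ?_⟩
        obtain ⟨i, hi, hfi⟩ := hfull m hm.le
        exact ⟨i, hi, by rintro rfl; omega, hfi⟩
    simp [this]
  · rw [← Nat.even_iff]
    -- If some label is missing, it is `N`. Then a door `j` has a label below `N`, repeated by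
    -- exactly one other index, and exchanging these two indices pairs off the doors.
    have key : ∀ j, (j ≤ N ∧ ∀ m < N, ∃ i ≤ N, i ≠ j ∧ f i = m) →
        Set.InjOn f ((Finset.range (N + 1)).erase j) ∧ f j < N := by
      rintro j ⟨hj, h⟩
      have hjN : f j < N := by
        refine lt_of_le_of_ne (hf j hj) fun hN => hfull fun m hm => ?_
        rcases hm.lt_or_eq with hm | rfl
        · obtain ⟨i, hi, -, hfi⟩ := h m hm
          exact ⟨i, hi, hfi⟩
        · exact ⟨j, hj, hN⟩
      refine ⟨?_, hjN⟩
      apply Finset.injOn_of_surjOn_of_card_le (t := Finset.range N) f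
      · intro i hi
        simp only [Finset.coe_erase, Finset.coe_range, Set.mem_sdiff, Set.mem_Iio,
          Set.mem_singleton_iff] at hi ⊢
        refine lt_of_le_of_ne (hf i (by omega)) fun hN => hfull fun m hm => ?_
        rcases hm.lt_or_eq with hm | rfl
        · obtain ⟨i, hi, -, hfi⟩ := h m hm
          exact ⟨i, hi, hfi⟩
        · exact ⟨i, by omega, hN⟩
      · intro m hm
        obtain ⟨i, hi, hij, hfi⟩ := h m (by simpa using hm)
        exact ⟨i, by simp; omega, hfi⟩
      · rw [Finset.card_erase_of_mem (by simp; omega)]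
        simp
    have hex : ∀ j, (j ≤ N ∧ ∀ m < N, ∃ i ≤ N, i ≠ j ∧ f i = m) →
        ∃ i ≤ N, i ≠ j ∧ f i = f j := fun j h => h.2 (f j) (key j h).2
    choose! g hgN hgne hgf using hex
    apply even_card_of_involution _ g
    · intro j hj
      simp only [Finset.mem_filter, Finset.mem_range, Nat.lt_succ_iff] at hj ⊢
      refine ⟨hgN j hj, fun m hm => ?_⟩
      obtain ⟨i, hi, hij, hfi⟩ := hj.2 m hm
      by_cases h : i = g j
      · exact ⟨j, hj.1, (hgne j hj).symm, by rw [← hgf j hj, ← h, hfi]⟩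
      · exact ⟨i, hi, h, hfi⟩
    · intro j hj
      simp only [Finset.mem_filter, Finset.mem_range, Nat.lt_succ_iff] at hj
      have hj' : g j ≤ N ∧ ∀ m < N, ∃ i ≤ N, i ≠ g j ∧ f i = m := by
        refine ⟨hgN j hj, fun m hm => ?_⟩
        obtain ⟨i, hi, hij, hfi⟩ := hj.2 m hm
        by_cases h : i = g j
        · exact ⟨j, hj.1, (hgne j hj).symm, by rw [← hgf j hj, ← h, hfi]⟩
        · exact ⟨i, hi, h, hfi⟩
      by_contra hne
      have h1 := hgN _ hj'
      have h2 := hgN _ hj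
      refine hgne _ hj' ((key j hj).1 ?_ ?_ (hgf _ hj'))
      · simp; omega
      · have := hgne _ hj
        simp; omega
    · intro j hj
      simp only [Finset.mem_filter, Finset.mem_range, Nat.lt_succ_iff] at hj
      exact hgne j hj

/-- A simplex of Kuhn's triangulation: a corner `C.1` and an ordering `C.2` of the coordinates. -/
abbrev Cell (N : ℕ) := (Fin N → ℕ) × (Fin N → ℕ)

/-- The vertices `0, …, N` of a simplex of Kuhn's triangulation. -/
def vertex {N : ℕ} (C : Cell N) (j : ℕ) : Fin N → ℕ :=
  fun c => C.1 c + if C.2 c < j then 1 else 0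

/-- The simplices of Kuhn's triangulation of the cube `{0, …, k} ^ N`. -/
def cells (N k : ℕ) : Finset (Cell N) := by
  classical exact (Fintype.piFinset fun _ => Finset.range k) ×ˢ
    ((Fintype.piFinset fun _ => Finset.range N).filter Function.Injective)

theorem mem_cells {N k : ℕ} {C : Cell N} :
    C ∈ cells N k ↔ (∀ c, C.1 c < k) ∧ (∀ c, C.2 c < N) ∧ Function.Injective C.2 := by
  simp [cells]

theorem exists_eq_of_mem_cells {N k : ℕ} {C : Cell N} (hC : C ∈ cells N k) {m : ℕ} (hm : m < N) :
    ∃ c, C.2 c = m := by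
  obtain ⟨-, h2, h3⟩ := mem_cells.1 hC
  have hinj : Function.Injective fun c : Fin N => (⟨C.2 c, h2 c⟩ : Fin N) :=
    fun a b hab => h3 (by simpa using hab)
  obtain ⟨c, hc⟩ := (Finite.injective_iff_surjective.1 hinj) ⟨m, hm⟩
  exact ⟨c, by simpa using hc⟩

/-- Sperner labelings of the grid `{0, …, k} ^ N` by `0, …, N`. -/
structure IsLabeling (N k : ℕ) (L : (Fin N → ℕ) → ℕ) : Prop where
  le : ∀ x, (∀ c, x c ≤ k) → L x ≤ N
  ne : ∀ x, (∀ c, x c ≤ k) → ∀ c : Fin N, x c = k → L x ≠ c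
  le_of_zero : ∀ x, (∀ c, x c ≤ k) → ∀ c : Fin N, x c = 0 → L x ≤ c

/-- All labels occur on the simplex `C`. -/
def Full {N : ℕ} (L : (Fin N → ℕ) → ℕ) (C : Cell N) : Prop :=
  ∀ m ≤ N, ∃ i ≤ N, L (vertex C i) = m

/-- The labels `0, …, N - 1` occur on the facet of `C` opposite to the vertex `j`. -/
def Door {N : ℕ} (L : (Fin N → ℕ) → ℕ) (C : Cell N) (j : ℕ) : Prop :=
  ∀ m < N, ∃ i ≤ N, i ≠ j ∧ L (vertex C i) = m

theorem vertex_le {N k : ℕ} {C : Cell N} (hC : C ∈ cells N k) (j : ℕ) (c : Fin N) :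
    vertex C j c ≤ k := by
  have := (mem_cells.1 hC).1 c
  unfold vertex
  split_ifs <;> omega

/-- Exchange of the directions `j - 1` and `j`. -/
def exchange {N : ℕ} (j : ℕ) (C : Cell N) : Cell N :=
  (C.1, fun c => if C.2 c = j - 1 then j else if C.2 c = j then j - 1 else C.2 c)

/-- The simplex on the other side of the facet opposite to the vertex `0`. -/
def moveUp {N : ℕ} (C : Cell N) : Cell N :=
  (fun c => C.1 c + if C.2 c = 0 then 1 else 0,
    fun c => if C.2 c = 0 then N - 1 else C.2 c - 1)

/-- The simplex on the other side of the facet opposite to the vertex `N`. -/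
def moveDown {N : ℕ} (C : Cell N) : Cell N :=
  (fun c => C.1 c - if C.2 c = N - 1 then 1 else 0,
    fun c => if C.2 c = N - 1 then 0 else C.2 c + 1)

theorem vertex_exchange {N : ℕ} (C : Cell N) {i j : ℕ} (hj : 0 < j) (hij : i ≠ j) :
    vertex (exchange j C) i = vertex C i := by
  funext c
  simp only [vertex, exchange]
  split_ifs <;> omega

theorem exchange_mem {N k : ℕ} {C : Cell N} (hC : C ∈ cells N k) {j : ℕ} (hjN : j < N) :
    exchange j C ∈ cells N k := by
  obtain ⟨h1, h2, h3⟩ := mem_cells.1 hC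
  refine mem_cells.2 ⟨h1, fun c => ?_, fun a b hab => h3 ?_⟩
  · have := h2 c
    simp only [exchange]
    split_ifs <;> omega
  · simp only [exchange] at hab
    split_ifs at hab <;> omega

theorem exchange_exchange {N : ℕ} (C : Cell N) (j : ℕ) :
    exchange j (exchange j C) = C := by
  refine Prod.ext rfl (funext fun c => ?_)
  simp only [exchange]
  split_ifs <;> omega

theorem exchange_ne {N k : ℕ} {C : Cell N} (hC : C ∈ cells N k) {j : ℕ} (hj : 0 < j)
    (hjN : j < N) : exchange j C ≠ C := by
  obtain ⟨c, hc⟩ := exists_eq_of_mem_cells hC hjN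
  intro h
  have := congrFun (congrArg Prod.snd h) c
  simp only [exchange, hc] at this
  split_ifs at this <;> omega

theorem door_exchange {N : ℕ} {L : (Fin N → ℕ) → ℕ} {C : Cell N} {j : ℕ} (hj : 0 < j) :
    Door L (exchange j C) j ↔ Door L C j := by
  unfold Door
  refine forall₂_congr fun m _ => exists_congr fun i => and_congr_right fun _ =>
    and_congr_right fun hij => ?_
  rw [vertex_exchange C hj hij]

theorem vertex_moveUp {N : ℕ} (C : Cell N) {i : ℕ} (hi : i < N) :
    vertex (moveUp C) i = vertex C (i + 1) := by
  funext c
  simp only [vertex, moveUp]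
  split_ifs <;> omega

theorem door_moveUp {N : ℕ} {L : (Fin N → ℕ) → ℕ} {C : Cell N} :
    Door L (moveUp C) N ↔ Door L C 0 := by
  unfold Door
  refine forall₂_congr fun m _ => ?_
  constructor
  · rintro ⟨i, hi, hiN, h⟩
    have hi' : i < N := by omega
    exact ⟨i + 1, by omega, by omega, by rw [← vertex_moveUp C hi', h]⟩
  · rintro ⟨i, hi, hi0, h⟩
    refine ⟨i - 1, by omega, by omega, ?_⟩
    rw [vertex_moveUp C (by omega), Nat.sub_add_cancel (by omega), h]

theorem moveDown_moveUp {N k : ℕ} {C : Cell N} (hC : C ∈ cells N k) :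
    moveDown (moveUp C) = C := by
  obtain ⟨h1, h2, h3⟩ := mem_cells.1 hC
  refine Prod.ext (funext fun c => ?_) (funext fun c => ?_) <;>
  · have := h2 c
    simp only [moveUp, moveDown]
    split_ifs <;> omega

theorem moveUp_moveDown {N k : ℕ} {C : Cell N} (hC : C ∈ cells N k)
    (h : ∀ c, C.2 c = N - 1 → 0 < C.1 c) : moveUp (moveDown C) = C := by
  obtain ⟨h1, h2, h3⟩ := mem_cells.1 hC
  refine Prod.ext (funext fun c => ?_) (funext fun c => ?_) <;>
  · have := h2 c
    have := h c
    by_cases hc : C.2 c = N - 1 <;> simp [moveUp, moveDown, hc] <;> omega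

theorem moveUp_mem {N k : ℕ} {C : Cell N} (hC : C ∈ cells N k)
    (h : ∀ c, C.2 c = 0 → C.1 c + 1 < k) : moveUp C ∈ cells N k := by
  obtain ⟨h1, h2, h3⟩ := mem_cells.1 hC
  refine mem_cells.2 ⟨fun c => ?_, fun c => ?_, fun a b hab => h3 ?_⟩
  · have := h1 c
    have := h c
    simp only [moveUp]
    split_ifs <;> omega
  · have := h2 c
    simp only [moveUp]
    split_ifs <;> omega
  · have := h2 a
    have := h2 b
    simp only [moveUp] at hab
    split_ifs at hab <;> omega

/-- Truncated subtraction keeps the corner in the grid even at the boundary; positivity is needed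
only for `moveUp_moveDown`. -/
theorem moveDown_mem {N k : ℕ} {C : Cell N} (hC : C ∈ cells N k) : moveDown C ∈ cells N k := by
  obtain ⟨h1, h2, h3⟩ := mem_cells.1 hC
  refine mem_cells.2 ⟨fun c => ?_, fun c => ?_, fun a b hab => h3 ?_⟩
  · have := h1 c
    simp only [moveDown]
    split_ifs <;> omega
  · have := h2 c
    simp only [moveDown]
    split_ifs <;> omega
  · have := h2 a
    have := h2 b
    simp only [moveDown] at hab
    split_ifs at hab <;> omega

/-- A door opposite to the vertex `0` does not lie on the boundary. -/
theorem lt_of_door_zero {N k : ℕ} {L : (Fin N → ℕ) → ℕ} (hL : IsLabeling N k L) {C : Cell N}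
    (hC : C ∈ cells N k) (hd : Door L C 0) (c : Fin N) (hc : C.2 c = 0) : C.1 c + 1 < k := by
  by_contra hk
  have h1 := (mem_cells.1 hC).1 c
  -- All vertices except `0` have coordinate `C.1 c + 1` in direction `c`. If this were `k`, the
  -- label `c` would be forbidden on the facet, but a door carries it.
  obtain ⟨i, hi, hi0, h⟩ := hd c c.2
  refine hL.ne _ (vertex_le hC i) c ?_ h
  simp only [vertex, hc]
  rw [if_pos (by omega)]
  omega

/-- A door opposite to the vertex `N` which lies on the boundary lies on the last face. -/
theorem eq_last_of_door {N k : ℕ} {L : (Fin (N + 1) → ℕ) → ℕ} (hL : IsLabeling (N + 1) k L)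
    {C : Cell (N + 1)} (hC : C ∈ cells (N + 1) k) (hd : Door L C (N + 1)) (c : Fin (N + 1))
    (hc : C.2 c = N) (h0 : C.1 c = 0) : c = Fin.last N := by
  -- The coordinate `c` is increased only at the vertex `N + 1`, so it is zero on the whole facet.
  -- The label `N`, which occurs there, must then be at most `c`.
  obtain ⟨i, hi, hi0, h⟩ := hd N (by omega)
  have := hL.le_of_zero _ (vertex_le hC i) c (by
    simp only [vertex, hc, h0]
    rw [if_neg (by omega)])
  apply Fin.ext
  simp only [Fin.val_last]
  omega

/-- The face `x_N = 0`, as a cube of dimension `N`. -/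
def extend {N : ℕ} (C : Cell N) : Cell (N + 1) :=
  (Fin.snoc (α := fun _ => ℕ) C.1 0, Fin.snoc (α := fun _ => ℕ) C.2 N)

theorem vertex_extend {N : ℕ} (C : Cell N) {i : ℕ} (hi : i ≤ N) :
    vertex (extend C) i = Fin.snoc (α := fun _ => ℕ) (vertex C i) 0 := by
  funext c
  refine Fin.lastCases ?_ (fun c => ?_) c
  · simp [vertex, extend, hi]
  · simp [vertex, extend]

theorem door_extend {N : ℕ} {L : (Fin (N + 1) → ℕ) → ℕ} {C : Cell N} :
    Door L (extend C) (N + 1) ↔ Full (fun x => L (Fin.snoc (α := fun _ => ℕ) x 0)) C := by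
  unfold Door Full
  constructor
  · intro h m hm
    obtain ⟨i, hi, hiN, h⟩ := h m (by omega)
    exact ⟨i, by omega, by simpa only [← vertex_extend C (show i ≤ N by omega)] using h⟩
  · intro h m hm
    obtain ⟨i, hi, h⟩ := h m (by omega)
    exact ⟨i, by omega, by omega, by simpa only [vertex_extend C hi] using h⟩

theorem extend_mem {N k : ℕ} (hk : 0 < k) {C : Cell N} (hC : C ∈ cells N k) :
    extend C ∈ cells (N + 1) k := by
  obtain ⟨h1, h2, h3⟩ := mem_cells.1 hC
  refine mem_cells.2 ⟨fun c => ?_, fun c => ?_, fun a b hab => ?_⟩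
  · refine Fin.lastCases ?_ (fun c => ?_) c
    · simpa [extend] using hk
    · simpa [extend] using h1 c
  · refine Fin.lastCases ?_ (fun c => ?_) c
    · simp [extend]
    · simpa [extend] using (h2 c).trans (Nat.lt_succ_self N)
  · revert hab
    refine Fin.lastCases ?_ (fun a => ?_) a <;> refine Fin.lastCases ?_ (fun b => ?_) b
    · simp
    · intro hab
      have := h2 b
      simp [extend] at hab
      omega
    · intro hab
      have := h2 a
      simp [extend] at hab
      omega
    · intro hab
      simp [extend] at hab
      rw [h3 hab]

/-- The condition `L x ≤ c` at zeros of `x c`, used for the last coordinate, removes the top label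
on the face, so the induction on dimension can proceed there. -/
theorem IsLabeling.restrict {N k : ℕ} {L : (Fin (N + 1) → ℕ) → ℕ} (hL : IsLabeling (N + 1) k L) :
    IsLabeling N k fun x => L (Fin.snoc (α := fun _ => ℕ) x 0) := by
  have hle : ∀ x : Fin N → ℕ, (∀ c, x c ≤ k) →
      ∀ c, (Fin.snoc (α := fun _ => ℕ) x 0 : Fin (N + 1) → ℕ) c ≤ k := by
    intro x hx c
    refine Fin.lastCases ?_ (fun c => ?_) c
    · simp
    · simpa using hx c
  refine ⟨fun x hx => ?_, fun x hx c hc => ?_, fun x hx c hc => ?_⟩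
  · simpa using hL.le_of_zero _ (hle x hx) (Fin.last N) (by simp)
  · simpa using hL.ne _ (hle x hx) c.castSucc (by simpa using hc)
  · simpa using hL.le_of_zero _ (hle x hx) c.castSucc (by simpa using hc)

/-- Kuhn's lemma: the number of simplices with all labels is odd. -/
theorem odd_card_full {N k : ℕ} (hk : 0 < k) {L : (Fin N → ℕ) → ℕ} (hL : IsLabeling N k L)
    [DecidablePred (Full L)] : Odd ((cells N k).filter (Full L)).card := by
  classical
  induction N with
  | zero =>
    have : (cells 0 k).filter (Full L) = {(![], ![])} := by
      ext C
      simp only [Finset.mem_filter, Finset.mem_singleton]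
      constructor
      · exact fun _ => Subsingleton.elim _ _
      · rintro rfl
        refine ⟨mem_cells.2 ⟨fun c => c.elim0, fun c => c.elim0, fun a => a.elim0⟩, fun m hm => ?_⟩
        have := hL.le (vertex (![], ![]) 0) fun c => c.elim0
        exact ⟨0, le_rfl, by omega⟩
    rw [this]
    simp
  | succ N ih =>
    set S := (cells (N + 1) k)
    have hS : ∀ C ∈ S, ((Finset.range (N + 2)).filter (Door L C)).card % 2
        = if Full L C then 1 else 0 := fun C hC => by
      convert card_doors_mod_two (N + 1) (fun j => L (vertex C j)) fun j _ =>
        hL.le _ (vertex_le hC j) <;> exact Iff.rfl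
    -- Pairs of a simplex and a door are counted modulo 2. Doors opposite to middle vertices pair
    -- off under `exchange`; doors opposite to vertex `0` cancel against the interior doors opposite
    -- to vertex `N + 1`. What survives lies on the last face and corresponds to its full simplices,
    -- which are odd in number by induction.
    have htotal : (∑ j ∈ Finset.range (N + 2), (S.filter fun C => Door L C j).card) ≡
        (S.filter (Full L)).card [MOD 2] := by
      simp only [Finset.card_filter]
      rw [Finset.sum_comm]
      refine Nat.ModEq.sum fun C hC => ?_
      rw [← Finset.card_filter]
      have := hS C hC
      unfold Nat.ModEq
      rw [this]
      split_ifs <;> rfl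
    have hmid : ∀ j ∈ Finset.range N, Even (S.filter fun C => Door L C (j + 1)).card := by
      intro j hj
      have hj := Finset.mem_range.1 hj
      apply even_card_of_involution _ (exchange (j + 1))
      · intro C hC
        rw [Finset.mem_filter] at hC ⊢
        exact ⟨exchange_mem hC.1 (by omega), (door_exchange (by omega)).2 hC.2⟩
      · exact fun C _ => exchange_exchange C _
      · intro C hC
        rw [Finset.mem_filter] at hC
        exact exchange_ne hC.1 (by omega) (by omega)
    have hdown : (S.filter fun C => Door L C 0).card =
        ((S.filter fun C => Door L C (N + 1)).filter fun C => ∀ c, C.2 c = N → 0 < C.1 c).card := by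
      refine Finset.card_nbij' moveUp moveDown ?_ ?_ ?_ ?_
      · intro C hC
        simp only [Finset.coe_filter, Finset.mem_filter, Set.mem_ofPred_eq] at hC ⊢
        refine ⟨⟨moveUp_mem hC.1 (lt_of_door_zero hL hC.1 hC.2), door_moveUp.2 hC.2⟩, fun c => ?_⟩
        have := (mem_cells.1 hC.1).2.1 c
        simp only [moveUp]
        split_ifs <;> omega
      · intro C hC
        simp only [Finset.coe_filter, Finset.mem_filter, Set.mem_ofPred_eq] at hC ⊢
        refine ⟨moveDown_mem hC.1.1, door_moveUp.1 ?_⟩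
        rw [moveUp_moveDown hC.1.1 (by simpa using hC.2)]
        exact hC.1.2
      · intro C hC
        simp only [Finset.coe_filter, Set.mem_ofPred_eq] at hC
        exact moveDown_moveUp hC.1
      · intro C hC
        simp only [Finset.coe_filter, Finset.mem_filter, Set.mem_ofPred_eq] at hC
        exact moveUp_moveDown hC.1.1 (by simpa using hC.2)
    have hface : ((cells N k).filter
        (Full fun x => L (Fin.snoc (α := fun _ => ℕ) x 0))).card =
        ((S.filter fun C => Door L C (N + 1)).filter
          fun C => ¬ ∀ c, C.2 c = N → 0 < C.1 c).card := by
      refine Finset.card_nbij' extend (fun C => (fun c => C.1 c.castSucc, fun c => C.2 c.castSucc))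
        ?_ ?_ ?_ ?_
      · intro C hC
        simp only [Finset.coe_filter, Finset.mem_filter, Set.mem_ofPred_eq] at hC ⊢
        refine ⟨⟨extend_mem hk hC.1, door_extend.2 hC.2⟩, fun h => ?_⟩
        have := h (Fin.last N) (by simp [extend])
        simp [extend] at this
      all_goals
        have hlast : ∀ C : Cell (N + 1), C ∈ S → Door L C (N + 1) →
            (¬ ∀ c, C.2 c = N → 0 < C.1 c) →
            C.2 (Fin.last N) = N ∧ C.1 (Fin.last N) = 0 ∧
            extend (fun c : Fin N => C.1 c.castSucc, fun c : Fin N => C.2 c.castSucc) = C := by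
          intro C hC hd h
          push Not at h
          obtain ⟨c, hc, h0⟩ := h
          obtain rfl := eq_last_of_door hL hC hd c hc (by omega)
          have h0 : C.1 (Fin.last N) = 0 := by omega
          refine ⟨hc, h0, Prod.ext (funext fun c => ?_) (funext fun c => ?_)⟩ <;>
          · refine Fin.lastCases ?_ (fun c => ?_) c <;> simp [extend, hc, h0]
      · intro C hC
        simp only [Finset.coe_filter, Finset.mem_filter, Set.mem_ofPred_eq] at hC ⊢
        obtain ⟨h2, h1, h⟩ := hlast C hC.1.1 hC.1.2 hC.2
        obtain ⟨g1, g2, g3⟩ := mem_cells.1 hC.1.1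
        refine ⟨mem_cells.2 ⟨fun c => g1 _, fun c => ?_, fun a b hab => ?_⟩, door_extend.1 ?_⟩
        · refine lt_of_le_of_ne (Nat.lt_succ_iff.1 (g2 c.castSucc)) fun hc => ?_
          have := g3 (hc.trans h2.symm)
          exact absurd this (Fin.castSucc_lt_last c).ne
        · exact Fin.castSucc_injective N (g3 hab)
        · rw [h]
          exact hC.1.2
      · intro C hC
        simp [extend]
      · intro C hC
        simp only [Finset.coe_filter, Finset.mem_filter, Set.mem_ofPred_eq] at hC
        exact (hlast C hC.1.1 hC.1.2 hC.2).2.2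
    have hodd := ih hL.restrict
    have hsplit := Finset.card_filter_add_card_filter_not (s := S.filter fun C => Door L C (N + 1))
      (fun C => ∀ c, C.2 c = N → 0 < C.1 c)
    rw [← hdown, ← hface] at hsplit
    have hmid' := Finset.even_sum _ hmid
    rw [Finset.sum_range_succ, Finset.sum_range_succ'] at htotal
    rw [Nat.odd_iff] at hodd ⊢
    rw [Nat.even_iff] at hmid'
    unfold Nat.ModEq at htotal
    omega

theorem exists_full {N k : ℕ} (hk : 0 < k) {L : (Fin N → ℕ) → ℕ} (hL : IsLabeling N k L) :
    ∃ C ∈ cells N k, Full L C := by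
  classical
  obtain ⟨C, hC⟩ := Finset.card_pos.1 (odd_card_full hk hL).pos
  exact ⟨C, (Finset.mem_filter.1 hC).1, (Finset.mem_filter.1 hC).2⟩

end Kuhn

/-! ### Lebesgue's covering theorem -/

namespace Kuhn

/-- The grid `{0, …, k} ^ N` in the unit cube. -/
noncomputable def gridPoint {N : ℕ} (k : ℕ) (x : Fin N → ℕ) : Fin N → unitInterval :=
  fun c => Set.projIcc 0 1 zero_le_one ((x c : ℝ) / k)

theorem gridPoint_eq_zero {N k : ℕ} {x : Fin N → ℕ} {c : Fin N} (h : x c = 0) :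
    gridPoint k x c = 0 := by
  simp only [gridPoint, h, Nat.cast_zero, zero_div]
  exact Set.projIcc_left _

theorem gridPoint_eq_one {N k : ℕ} (hk : 0 < k) {x : Fin N → ℕ} {c : Fin N} (h : x c = k) :
    gridPoint k x c = 1 := by
  have : (k : ℝ) ≠ 0 := by positivity
  simp only [gridPoint, h, div_self this]
  exact Set.projIcc_right _

theorem dist_gridPoint_vertex_le {N k : ℕ} (C : Cell N) (i j : ℕ) :
    dist (gridPoint k (vertex C i)) (gridPoint k (vertex C j)) ≤ 1 / k := by
  rw [dist_pi_le_iff (by positivity)]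
  intro c
  have h := (LipschitzWith.projIcc (zero_le_one (α := ℝ))).dist_le_mul
    ((vertex C i c : ℝ) / k) ((vertex C j c : ℝ) / k)
  refine h.trans ?_
  rw [NNReal.coe_one, one_mul, Real.dist_eq, ← sub_div, abs_div, Nat.abs_cast]
  gcongr
  simp only [vertex]
  push_cast
  rw [add_sub_add_left_eq_sub]
  split_ifs <;> simp

/-- Supplies the label of a member of the cover. Choosing the first zero face that it meets yields
`le_of_zero`; a member meeting a zero face misses the opposite one, which yields `ne`. -/
theorem exists_first_face {N : ℕ} (V : Set (Fin N → unitInterval)) :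
    ∃ m ≤ N, (∀ c : Fin N, (∃ x ∈ V, x c = 0) → m ≤ c) ∧
      ∀ c : Fin N, m = c → ∃ x ∈ V, x c = 0 := by
  classical
  by_cases h : ∃ m, ∃ c : Fin N, (c : ℕ) = m ∧ ∃ x ∈ V, x c = 0
  · obtain ⟨c, hc, hx⟩ := Nat.find_spec h
    refine ⟨Nat.find h, by omega, fun c hc => Nat.find_min' h ⟨c, rfl, hc⟩, fun c' hc' => ?_⟩
    obtain rfl : c = c' := Fin.ext (hc.trans hc')
    exact hx
  · push Not at h
    refine ⟨N, le_rfl, fun c ⟨x, hx, hc⟩ => absurd hc (h c c rfl x hx), fun c hc => ?_⟩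
    have := c.2
    omega

/-- Lebesgue's covering theorem: if no member of an open cover of the unit cube meets two opposite
faces, then some point of the cube lies in `N + 1` members. -/
theorem exists_le_encard_of_cover {N : ℕ} (𝒱 : Set (Set (Fin N → unitInterval)))
    (hopen : ∀ V ∈ 𝒱, IsOpen V) (hcov : ⋃₀ 𝒱 = univ)
    (hface : ∀ V ∈ 𝒱, ∀ i, (∀ x ∈ V, x i ≠ 0) ∨ ∀ x ∈ V, x i ≠ 1) :
    ∃ x, ((N : ℕ∞) + 1) ≤ {V ∈ 𝒱 | x ∈ V}.encard := by
  obtain ⟨δ, hδ, hball⟩ := lebesgue_number_lemma_of_metric_sUnion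
    (isCompact_univ (X := Fin N → unitInterval)) hopen hcov.ge
  choose U hU𝒱 hU using fun x => hball x (mem_univ x)
  choose label hle hzero heq using exists_first_face (N := N)
  obtain ⟨n, hn⟩ := exists_nat_one_div_lt hδ
  set k := n + 1
  have hk : 0 < k := Nat.succ_pos n
  have hn : 1 / (k : ℝ) < δ := by simpa [k] using hn
  have hself : ∀ x, x ∈ U x := fun x => hU x (Metric.mem_ball_self hδ)
  have hL : IsLabeling N k fun x => label (U (gridPoint k x)) := by
    refine ⟨fun x _ => hle _, fun x _ c hc hlab => ?_, fun x _ c hc => ?_⟩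
    · obtain ⟨y, hy, hyc⟩ := heq _ c hlab
      rcases hface _ (hU𝒱 (gridPoint k x)) c with h | h
      · exact h y hy hyc
      · exact h _ (hself _) (gridPoint_eq_one hk hc)
    · exact hzero _ c ⟨_, hself _, gridPoint_eq_zero hc⟩
  obtain ⟨C, -, hC⟩ := exists_full hk hL
  choose! i hi hlab using hC
  refine ⟨gridPoint k (vertex C 0), ?_⟩
  have hmem : ∀ m, gridPoint k (vertex C 0) ∈ U (gridPoint k (vertex C (i m))) := fun m =>
    hU _ (Metric.mem_ball.2 ((dist_gridPoint_vertex_le C 0 (i m)).trans_lt hn))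
  -- The label is a function of the cover member alone, so distinct labels force distinct members.
  -- All of them contain the vertex `0`, since the mesh is below the Lebesgue number.
  have hinj : Set.InjOn (fun m => U (gridPoint k (vertex C (i m)))) (Set.Iic N) := by
    intro a ha b hb hab
    rw [← hlab a ha, ← hlab b hb]
    exact congrArg label hab
  calc ((N : ℕ∞) + 1) = (Set.Iic N).encard := by
        rw [← Finset.coe_Iic, Set.encard_coe_eq_coe_finsetCard, Nat.card_Iic]
        push_cast
        rfl
    _ = ((fun m => U (gridPoint k (vertex C (i m)))) '' Set.Iic N).encard :=
        hinj.encard_image.symm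
    _ ≤ _ := Set.encard_le_encard (by
        rintro _ ⟨m, -, rfl⟩
        exact ⟨hU𝒱 _, hmem m⟩)

end Kuhn

/-! ### Lower bounds for `widim` from cubes -/

namespace FlowComplexity

/-- A space into which the cube of dimension `N` maps continuously with disjoint images of opposite
faces has covering dimension at least `N`. -/
theorem le_of_coveringDimLE {P : Type*} [TopologicalSpace P] [T2Space P] {N n : ℕ}
    (hP : CoveringDimLE P n) (G : (Fin N → unitInterval) → P) (hG : Continuous G)
    (hface : ∀ i a b, a i = 0 → b i = 1 → G a ≠ G b) : N ≤ n := by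
  classical
  -- `A i true` and `A i false` omit the images of the faces `x i = 0` and `x i = 1`. These images
  -- are disjoint, so the two sets cover `P`, and so do the intersections `W s`. Every member of a
  -- refinement then misses one of each two opposite faces.
  let A : Fin N → Bool → Set P := fun i s => (G '' {a | a i = if s then 0 else 1})ᶜ
  have hA : ∀ i s, IsOpen (A i s) := fun i s =>
    ((isClosed_eq (continuous_apply i) continuous_const).isCompact.image hG).isClosed.isOpen_compl
  let W : (Fin N → Bool) → Set P := fun s => ⋂ i, A i (s i)
  obtain ⟨𝒱, hopen, hcov, href, hord⟩ := hP (Set.range W) (Set.finite_range W)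
    (by
      rintro _ ⟨s, rfl⟩
      exact isOpen_iInter_of_finite fun i => hA i _)
    (by
      refine eq_univ_of_forall fun p => ?_
      have : ∀ i, ∃ s, p ∈ A i s := by
        intro i
        by_contra! h
        obtain ⟨a, ha, hap⟩ := not_not.1 (h true)
        obtain ⟨b, hb, hbp⟩ := not_not.1 (h false)
        exact hface i a b (by simpa using ha) (by simpa using hb) (hap.trans hbp.symm)
      choose s hs using this
      exact ⟨W s, ⟨s, rfl⟩, mem_iInter.2 hs⟩)
  obtain ⟨x, hx⟩ := Kuhn.exists_le_encard_of_cover ((fun V => G ⁻¹' V) '' 𝒱)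
    (by
      rintro _ ⟨V, hV, rfl⟩
      exact (hopen V hV).preimage hG)
    (by
      refine eq_univ_of_forall fun x => ?_
      obtain ⟨V, hV, hxV⟩ := hcov.ge (mem_univ (G x))
      exact ⟨_, ⟨V, hV, rfl⟩, hxV⟩)
    (by
      rintro _ ⟨V, hV, rfl⟩ i
      obtain ⟨_, ⟨s, rfl⟩, hVs⟩ := href V hV
      have hVi : V ⊆ A i (s i) := hVs.trans (iInter_subset _ i)
      cases hsi : s i with
      | true => exact Or.inl fun x hx h0 => hVi hx ⟨x, by simpa [hsi] using h0, rfl⟩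
      | false => exact Or.inr fun x hx h1 => hVi hx ⟨x, by simpa [hsi] using h1, rfl⟩)
  have hsub : {V ∈ (fun V => G ⁻¹' V) '' 𝒱 | x ∈ V} ⊆
      (fun V => G ⁻¹' V) '' {V ∈ 𝒱 | G x ∈ V} := by
    rintro _ ⟨⟨V, hV, rfl⟩, hxV⟩
    exact ⟨V, ⟨hV, hxV⟩, rfl⟩
  have h := hx.trans ((Set.encard_le_encard hsub).trans
    ((Set.encard_image_le _ _).trans (hord (G x))))
  have h' : N + 1 ≤ n + 1 := by exact_mod_cast h
  omega

theorem le_widim {X : Type*} [TopologicalSpace X] {d : X → X → ℝ} {ε : ℝ} {N : ℕ}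
    (F : (Fin N → unitInterval) → X) (hF : Continuous F)
    (hface : ∀ i a b, a i = 0 → b i = 1 → ε < d (F a) (F b)) : (N : ℕ∞) ≤ widim d ε := by
  refine le_sInf ?_
  rintro m ⟨P, _, _, _, rfl, f, hf, hfd⟩
  refine le_sInf ?_
  rintro m ⟨n, rfl, hn⟩
  exact_mod_cast le_of_coveringDimLE hn (f ∘ F) (hf.comp hF) fun i a b ha hb hab =>
    (hface i a b ha hb).not_ge (hfd _ _ hab)

end FlowComplexity

/-! ### Time changes of flows -/

namespace FlowComplexity

section Clock

variable {Z : Type*} [TopologicalSpace Z] (φ : Flow ℝ Z) (w : Z → ℝ)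

/-- The time that the orbit segment `φ_[0,t] z` takes if the time runs at the rate `w`. -/
noncomputable def clock (z : Z) (t : ℝ) : ℝ := ∫ s in (0 : ℝ)..t, w (φ s z)

variable {φ w}

theorem clock_zero (z : Z) : clock φ w z 0 = 0 := by simp [clock]

theorem continuous_rate (hw : Continuous w) (z : Z) : Continuous fun s => w (φ s z) :=
  hw.comp (φ.continuous continuous_id continuous_const)

theorem clock_add (hw : Continuous w) (z : Z) (s t : ℝ) :
    clock φ w z (s + t) = clock φ w z s + clock φ w (φ s z) t := by
  have h := intervalIntegral.integral_add_adjacent_intervals (μ := MeasureTheory.volume)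
    ((continuous_rate (φ := φ) hw z).intervalIntegrable 0 s)
    ((continuous_rate (φ := φ) hw z).intervalIntegrable s (s + t))
  rw [clock, ← h, clock, clock]
  congr 1
  have := intervalIntegral.integral_comp_add_right (fun u => w (φ u z)) s (a := 0) (b := t)
  simp only [φ.map_add, zero_add] at this
  rw [add_comm s t, ← this]

theorem le_clock (hw : Continuous w) (hw1 : ∀ z, 1 ≤ w z) (z : Z) {t : ℝ} (ht : 0 ≤ t) :
    t ≤ clock φ w z t := by
  have := intervalIntegral.integral_mono_on (μ := MeasureTheory.volume) ht
    ((continuous_const (y := (1 : ℝ))).intervalIntegrable 0 t)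
    ((continuous_rate (φ := φ) hw z).intervalIntegrable 0 t) fun s _ => hw1 (φ s z)
  simpa [clock] using this

theorem sub_le_clock_sub (hw : Continuous w) (hw1 : ∀ z, 1 ≤ w z) (z : Z) {s t : ℝ}
    (hst : s ≤ t) : t - s ≤ clock φ w z t - clock φ w z s := by
  have h := clock_add (φ := φ) hw z s (t - s)
  have := le_clock (φ := φ) hw hw1 (φ s z) (sub_nonneg.2 hst)
  rw [add_sub_cancel] at h
  linarith

theorem clock_strictMono (hw : Continuous w) (hw1 : ∀ z, 1 ≤ w z) (z : Z) :
    StrictMono (clock φ w z) := fun s t hst => by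
  have := sub_le_clock_sub (φ := φ) hw hw1 z hst.le
  linarith

theorem continuous_clock (hw : Continuous w) :
    Continuous fun q : Z × ℝ => clock φ w q.1 q.2 := by
  refine intervalIntegral.continuous_parametric_intervalIntegral_of_continuous
    (f := fun (q : Z × ℝ) s => w (φ s q.1)) ?_ continuous_snd
  exact hw.comp (φ.continuous continuous_snd (continuous_fst.comp continuous_fst))

theorem clock_surjective (hw : Continuous w) (hw1 : ∀ z, 1 ≤ w z) (z : Z) :
    Function.Surjective (clock φ w z) := by
  refine Continuous.surjective
    ((continuous_clock (φ := φ) hw).comp (continuous_const.prodMk continuous_id)) ?_ ?_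
  · refine tendsto_atTop_mono' _ ?_ tendsto_id
    filter_upwards [eventually_ge_atTop 0] with t ht using le_clock hw hw1 z ht
  · refine tendsto_atBot_mono' _ ?_ tendsto_id
    filter_upwards [eventually_le_atBot 0] with t ht
    have := sub_le_clock_sub (φ := φ) hw hw1 z ht
    rw [clock_zero] at this
    simp only [id]
    change clock φ w z t ≤ t
    linarith

/-- The time change along the orbit of `z`, as an increasing bijection of the line. -/
noncomputable def clockIso (hw : Continuous w) (hw1 : ∀ z, 1 ≤ w z) (z : Z) : ℝ ≃o ℝ :=
  (clock_strictMono (φ := φ) hw hw1 z).orderIsoOfSurjective _ (clock_surjective hw hw1 z)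

theorem clockIso_apply (hw : Continuous w) (hw1 : ∀ z, 1 ≤ w z) (z : Z) (t : ℝ) :
    clockIso (φ := φ) hw hw1 z t = clock φ w z t := rfl

/-- The original time that passes while the clock moves from `0` to `s`. -/
noncomputable def unclock (φ : Flow ℝ Z) (hw : Continuous w) (hw1 : ∀ z, 1 ≤ w z)
    (z : Z) (s : ℝ) : ℝ :=
  (clockIso (φ := φ) hw hw1 z).symm s

variable (hw : Continuous w) (hw1 : ∀ z, 1 ≤ w z)

theorem clock_unclock (z : Z) (s : ℝ) : clock φ w z (unclock φ hw hw1 z s) = s :=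
  (clockIso (φ := φ) hw hw1 z).apply_symm_apply s

theorem unclock_clock (z : Z) (t : ℝ) : unclock φ hw hw1 z (clock φ w z t) = t :=
  (clockIso (φ := φ) hw hw1 z).symm_apply_apply t

theorem unclock_zero (z : Z) : unclock φ hw hw1 z 0 = 0 := by
  conv_lhs => rw [← clock_zero (φ := φ) (w := w) z]
  exact unclock_clock hw hw1 z 0

theorem unclock_strictMono (z : Z) : StrictMono (unclock φ hw hw1 z) :=
  (clockIso (φ := φ) hw hw1 z).symm.strictMono

theorem unclock_add (z : Z) (s t : ℝ) :
    unclock φ hw hw1 z (s + t) =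
      unclock φ hw hw1 z s + unclock φ hw hw1 (φ (unclock φ hw hw1 z s) z) t := by
  apply (clock_strictMono (φ := φ) hw hw1 z).injective
  rw [clock_add hw, clock_unclock, clock_unclock, clock_unclock]

theorem abs_unclock_le (z : Z) (s : ℝ) : |unclock φ hw hw1 z s| ≤ |s| := by
  set t := unclock φ hw hw1 z s with ht
  have hs : clock φ w z t = s := clock_unclock hw hw1 z s
  rcases le_total 0 t with h | h
  · rw [abs_of_nonneg h]
    exact (le_clock (φ := φ) hw hw1 z h).trans (hs.le.trans (le_abs_self s))
  · have := sub_le_clock_sub (φ := φ) hw hw1 z h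
    rw [clock_zero, hs] at this
    rw [abs_of_nonpos h]
    exact le_trans (by linarith) (neg_le_abs s)

/-- Strict monotonicity turns bounds on `unclock` into bounds on `clock` at a fixed time, which are
open conditions because `clock` is continuous. -/
theorem continuous_unclock : Continuous fun q : Z × ℝ => unclock φ hw hw1 q.1 q.2 := by
  have hlt : ∀ (a : ℝ) (q : Z × ℝ), a < unclock φ hw hw1 q.1 q.2 ↔ clock φ w q.1 a < q.2 := by
    intro a q
    rw [← (clock_strictMono (φ := φ) hw hw1 q.1).lt_iff_lt, clock_unclock]
  have hgt : ∀ (a : ℝ) (q : Z × ℝ), unclock φ hw hw1 q.1 q.2 < a ↔ q.2 < clock φ w q.1 a := by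
    intro a q
    rw [← (clock_strictMono (φ := φ) hw hw1 q.1).lt_iff_lt, clock_unclock]
  have hc : ∀ a : ℝ, Continuous fun q : Z × ℝ => clock φ w q.1 a := fun a =>
    (continuous_clock (φ := φ) hw).comp (continuous_fst.prodMk continuous_const)
  refine continuous_iff_continuousAt.2 fun q => tendsto_order.2 ⟨fun a ha => ?_, fun a ha => ?_⟩
  · filter_upwards [(isOpen_lt (hc a) continuous_snd).mem_nhds ((hlt a q).1 ha)] with q' hq'
    exact (hlt a q').2 hq'
  · filter_upwards [(isOpen_lt continuous_snd (hc a)).mem_nhds ((hgt a q).1 ha)] with q' hq'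
    exact (hgt a q').2 hq'

/-- The flow along the orbits of `φ` in which time runs at the rate `w`. -/
noncomputable def timeChange (φ : Flow ℝ Z) (hw : Continuous w) (hw1 : ∀ z, 1 ≤ w z) :
    Flow ℝ Z where
  toFun s z := φ (unclock φ hw hw1 z s) z
  cont' := φ.continuous ((continuous_unclock hw hw1).comp continuous_swap) continuous_snd
  map_add' s t z := by
    rw [add_comm s t, unclock_add, add_comm, φ.map_add]
  map_zero' z := by rw [unclock_zero, φ.map_zero_apply]

theorem timeChange_apply (s : ℝ) (z : Z) :
    timeChange φ hw hw1 s z = φ (unclock φ hw hw1 z s) z := rfl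

theorem timeChange_clock (t : ℝ) (z : Z) :
    timeChange φ hw hw1 (clock φ w z t) z = φ t z := by
  rw [timeChange_apply, unclock_clock]

theorem unclock_natCast (z : Z) (m : ℕ) :
    unclock φ hw hw1 z m = ∑ k ∈ Finset.range m, unclock φ hw hw1 (timeChange φ hw hw1 k z) 1 := by
  induction m with
  | zero => simp [unclock_zero]
  | succ m ih => rw [Finset.sum_range_succ, ← ih, Nat.cast_succ, unclock_add, timeChange_apply]

theorem unclock_nonneg (z : Z) {s : ℝ} (hs : 0 ≤ s) : 0 ≤ unclock φ hw hw1 z s := by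
  have h := (unclock_strictMono (φ := φ) hw hw1 z).monotone hs
  rwa [unclock_zero] at h

theorem unclock_pos (z : Z) {s : ℝ} (hs : 0 < s) : 0 < unclock φ hw hw1 z s := by
  have h := unclock_strictMono (φ := φ) hw hw1 z hs
  rwa [unclock_zero] at h

theorem continuous_unclock_left (s : ℝ) : Continuous fun z => unclock φ hw hw1 z s := by
  have h : Continuous fun z : Z => (z, s) := by fun_prop
  have h2 := (continuous_unclock (φ := φ) hw hw1).comp h
  change Continuous fun z => unclock φ hw hw1 z s at h2
  exact h2

/-- The original time is the sum of the original times of unit clock steps, and each step that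
starts in `P` contributes at least `c`. This converts a bound on original time into a bound on the
number of visits. -/
theorem card_mul_le_unclock (P : Z → Prop) [DecidablePred P] {c : ℝ}
    (hc : ∀ z, P z → c ≤ unclock φ hw hw1 z 1) (z : Z) (m : ℕ) :
    (((Finset.range m).filter fun k : ℕ => P (timeChange φ hw hw1 k z)).card : ℝ) * c ≤
      unclock φ hw hw1 z m := by
  rw [unclock_natCast, ← nsmul_eq_mul, ← Finset.sum_const]
  refine (Finset.sum_le_sum fun k hk => hc _ (Finset.mem_filter.1 hk).2).trans
    (Finset.sum_le_sum_of_subset_of_nonneg (Finset.filter_subset _ _) fun k _ _ =>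
      unclock_nonneg hw hw1 _ zero_le_one)

theorem mul_le_clock (hw : Continuous w) {M c : ℝ} (h : ∀ z, c ≤ clock φ w z M) (z : Z) (j : ℕ) :
    j * c ≤ clock φ w z (j * M) := by
  induction j with
  | zero => simp [clock_zero]
  | succ j ih =>
    have := clock_add (φ := φ) hw z (j * M) M
    have h2 := h (φ (j * M) z)
    push_cast
    rw [add_mul, one_mul, add_mul, one_mul, this]
    linarith

/-- If the clock runs at an unbounded rate on long orbit segments, then the original time that
passes during a long time of the clock is comparatively short. -/
theorem exists_unclock_le (hslow : ∀ n : ℕ, ∃ M > 0, ∀ z, n * M ≤ clock φ w z M) {η : ℝ}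
    (hη : 0 < η) : ∃ C, ∀ z, ∀ r ≥ 0, unclock φ hw hw1 z r ≤ η * r + C := by
  obtain ⟨n, hn⟩ := exists_nat_gt (1 / η)
  obtain ⟨M, hM, h⟩ := hslow n
  refine ⟨M, fun z r hr => ?_⟩
  -- Cut `[0, t]` into blocks of length `M`, each costing at least `n * M` on the clock. Hence `n *
  -- (t - M) ≤ r`, and `1 / n < η` gives the claim with `C = M`.
  set t := unclock φ hw hw1 z r with htdef
  have ht : 0 ≤ t := by
    rw [htdef, ← unclock_zero hw hw1 z]
    exact (unclock_strictMono hw hw1 z).monotone hr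
  have h1 := mul_le_clock hw h z ⌊t / M⌋₊
  have h2 : (⌊t / M⌋₊ : ℝ) * M ≤ t := by
    rw [← le_div_iff₀ hM]
    exact Nat.floor_le (by positivity)
  have h3 := (clock_strictMono (φ := φ) hw hw1 z).monotone h2
  rw [clock_unclock] at h3
  have h4 : t < (⌊t / M⌋₊ + 1) * M := by
    rw [← div_lt_iff₀ hM]
    exact Nat.lt_floor_add_one _
  have hn0 : 0 < (n : ℝ) := lt_trans (by positivity) hn
  have h5 : n * (t - M) ≤ r := by nlinarith
  have h6 : 1 < n * η := by rwa [div_lt_iff₀ hη] at hn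
  by_contra! h7
  have h8 : η * r < t - M := by linarith
  have h9 : r ≤ n * (η * r) := by nlinarith
  nlinarith

end Clock

/-! ### Time changes whose rate may blow up at a fixed point -/

section Extend

variable {X : Type*} [TopologicalSpace X] (φ : Flow ℝ X) {p : X}

theorem isInvariant_compl_fixedPoint (hp : IsFixedPoint φ p) : IsInvariant φ {p}ᶜ := by
  intro t x hx hxp
  apply hx
  have := φ.map_add (-t) t x
  rw [neg_add_cancel, φ.map_zero_apply, show φ t x = p from hxp, hp] at this
  exact this

/-- The flow `φ` on the complement of a fixed point. -/
noncomputable def awayFlow (hp : IsFixedPoint φ p) : Flow ℝ ({p}ᶜ : Set X) :=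
  φ.restrict (isInvariant_compl_fixedPoint φ hp)

theorem coe_awayFlow (hp : IsFixedPoint φ p) (t : ℝ) (z : ({p}ᶜ : Set X)) :
    (awayFlow φ hp t z : X) = φ t z := rfl

variable {w : ({p}ᶜ : Set X) → ℝ}

open Classical in
/-- The time change of `φ` at a rate `w` which is defined away from a fixed point. -/
noncomputable def slowMap (hp : IsFixedPoint φ p) (hw : Continuous w) (hw1 : ∀ z, 1 ≤ w z)
    (s : ℝ) (x : X) : X :=
  if h : x = p then p else timeChange (awayFlow φ hp) hw hw1 s ⟨x, h⟩

variable (hp : IsFixedPoint φ p) (hw : Continuous w) (hw1 : ∀ z, 1 ≤ w z)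

theorem slowMap_fixedPoint (s : ℝ) : slowMap φ hp hw hw1 s p = p := dif_pos rfl

theorem slowMap_coe (s : ℝ) (z : ({p}ᶜ : Set X)) :
    slowMap φ hp hw hw1 s z = timeChange (awayFlow φ hp) hw hw1 s z := dif_neg z.2

theorem exists_slowMap_eq (s : ℝ) (x : X) :
    ∃ t, |t| ≤ |s| ∧ slowMap φ hp hw hw1 s x = φ t x := by
  by_cases h : x = p
  · subst h
    exact ⟨0, by simp, by rw [slowMap_fixedPoint, φ.map_zero_apply]⟩
  · exact ⟨_, abs_unclock_le hw hw1 ⟨x, h⟩ s, slowMap_coe φ hp hw hw1 s ⟨x, h⟩⟩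

variable [T1Space X]

theorem continuous_slowMap : Continuous fun q : ℝ × X => slowMap φ hp hw hw1 q.1 q.2 := by
  refine continuous_iff_continuousAt.2 ?_
  rintro ⟨s, x⟩
  by_cases h : x = p
  · subst h
    rw [ContinuousAt, slowMap_fixedPoint]
    intro U hU
    -- At the fixed point the behavior of `w` is irrelevant: the new map moves a point along `φ` for
    -- a time of absolute value at most `|s| + 1`, and `φ` keeps nearby points in `U` uniformly over
    -- this compact range.
    have hK : ∀ t ∈ Icc (-(|s| + 1)) (|s| + 1), ∀ᶠ q : ℝ × X in 𝓝 (t, x), φ q.1 q.2 ∈ U := by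
      intro t _
      have : ContinuousAt (fun q : ℝ × X => φ q.1 q.2) (t, x) :=
        (φ.continuous continuous_fst continuous_snd).continuousAt
      apply this
      change U ∈ 𝓝 (φ t x)
      rwa [hp t]
    have hK' := (isCompact_Icc (a := -(|s| + 1)) (b := |s| + 1)).eventually_forall_of_forall_eventually
      (P := fun y t => φ t y ∈ U) (x₀ := x) fun t ht => by
        exact (continuous_swap (X := X) (Y := ℝ)).tendsto (x, t) |>.eventually (hK t ht)
    have hs : ∀ᶠ s' in 𝓝 s, |s'| < |s| + 1 :=
      (continuous_abs.tendsto s).eventually (gt_mem_nhds (lt_add_one _))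
    have hq : ∀ᶠ q : ℝ × X in 𝓝 (s, x), |q.1| < |s| + 1 ∧
        ∀ t ∈ Icc (-(|s| + 1)) (|s| + 1), φ t q.2 ∈ U := by
      rw [nhds_prod_eq]
      exact hs.prod_mk hK'
    refine mem_map.2 ?_
    filter_upwards [hq] with q hq
    obtain ⟨t, ht, hqt⟩ := exists_slowMap_eq φ hp hw hw1 q.1 q.2
    change slowMap φ hp hw hw1 q.1 q.2 ∈ U
    rw [hqt]
    exact hq.2 t (abs_le.1 (ht.trans hq.1.le))
  · have hemb : IsOpenEmbedding (Prod.map (id : ℝ → ℝ) ((↑) : ({p}ᶜ : Set X) → X)) :=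
      IsOpenEmbedding.id.prodMap isOpen_compl_singleton.isOpenEmbedding_subtypeVal
    have := (hemb.continuousAt_iff (g := fun q : ℝ × X => slowMap φ hp hw hw1 q.1 q.2)
      (x := (s, ⟨x, h⟩))).1 (by
        have hc : Continuous fun q : ℝ × ({p}ᶜ : Set X) =>
            (timeChange (awayFlow φ hp) hw hw1 q.1 q.2 : X) :=
          continuous_subtype_val.comp (Flow.continuous _ continuous_fst continuous_snd)
        refine hc.continuousAt.congr (Eventually.of_forall fun q => ?_)
        exact (slowMap_coe φ hp hw hw1 q.1 q.2).symm)
    exact this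

/-- The time change of `φ` at a rate `w` which is defined away from a fixed point, as a flow. -/
noncomputable def slowFlow : Flow ℝ X where
  toFun := slowMap φ hp hw hw1
  cont' := continuous_slowMap φ hp hw hw1
  map_add' s t x := by
    by_cases h : x = p
    · subst h
      simp only [slowMap_fixedPoint]
    · obtain ⟨z, rfl⟩ : ∃ z : ({p}ᶜ : Set X), (z : X) = x := ⟨⟨x, h⟩, rfl⟩
      simp only [slowMap_coe, Flow.map_add]
  map_zero' x := by
    by_cases h : x = p
    · subst h
      simp only [slowMap_fixedPoint]
    · obtain ⟨z, rfl⟩ : ∃ z : ({p}ᶜ : Set X), (z : X) = x := ⟨⟨x, h⟩, rfl⟩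
      simp only [slowMap_coe, Flow.map_zero_apply]

theorem slowFlow_fixedPoint : IsFixedPoint (slowFlow φ hp hw hw1) p :=
  slowMap_fixedPoint φ hp hw hw1

theorem slowFlow_coe (s : ℝ) (z : ({p}ᶜ : Set X)) :
    slowFlow φ hp hw hw1 s z = timeChange (awayFlow φ hp) hw hw1 s z :=
  slowMap_coe φ hp hw hw1 s z

/-- The identity is the homeomorphism, with `clock` as the change of time on each orbit; at the
fixed point any change of time works. -/
theorem weaklyEquivalent_slowFlow : WeaklyEquivalent φ (slowFlow φ hp hw hw1) := by
  refine ⟨Homeomorph.refl X, fun x => ?_⟩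
  by_cases h : x = p
  · subst h
    refine ⟨OrderIso.refl ℝ, rfl, fun t => ?_⟩
    change φ t x = slowFlow φ hp hw hw1 t x
    rw [hp, slowFlow_fixedPoint]
  · obtain ⟨z, rfl⟩ : ∃ z : ({p}ᶜ : Set X), (z : X) = x := ⟨⟨x, h⟩, rfl⟩
    refine ⟨clockIso (φ := awayFlow φ hp) hw hw1 z, clock_zero z, fun t => ?_⟩
    change φ t z = slowFlow φ hp hw hw1 (clockIso (φ := awayFlow φ hp) hw hw1 z t) z
    rw [slowFlow_coe, clockIso_apply, timeChange_clock, coe_awayFlow]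

end Extend

end FlowComplexity

/-! ### Slow flows spend most of the time near the fixed point -/

namespace FlowComplexity

section Rate

variable {X : Type*} [MetricSpace X] (φ : Flow ℝ X) {p : X}

/-- There is a rate on the complement of a fixed point that is arbitrarily large on prescribed
balls around it. -/
theorem exists_rate (p : X) (A : ℕ → ℝ) :
    ∃ w : ({p}ᶜ : Set X) → ℝ, Continuous w ∧ (∀ z, 1 ≤ w z) ∧
      ∀ n : ℕ, ∀ z : ({p}ᶜ : Set X), dist (z : X) p ≤ 1 / (n + 1) → A n ≤ w z := by
  -- The conditions on the value are convex, so a local choice of constants suffices. Near `z` only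
  -- the finitely many `n < m` impose a condition, and `1 + ∑ |A n|` meets them all.
  obtain ⟨g, hg⟩ := exists_continuous_forall_mem_convex_of_local_const
    (X := ({p}ᶜ : Set X)) (E := ℝ)
    (t := fun z => {c | 1 ≤ c ∧ ∀ n : ℕ, dist (z : X) p ≤ 1 / (n + 1) → A n ≤ c})
    (fun z => by
      have : {c | 1 ≤ c ∧ ∀ n : ℕ, dist (z : X) p ≤ 1 / (n + 1) → A n ≤ c} =
          Ici 1 ∩ ⋂ (n : ℕ) (_ : dist (z : X) p ≤ 1 / (n + 1)), Ici (A n) := by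
        ext c
        simp
      rw [this]
      exact (convex_Ici 1).inter (convex_iInter₂ fun n _ => convex_Ici (A n)))
    (fun z => by
      have hz : 0 < dist (z : X) p := dist_pos.2 z.2
      obtain ⟨m, hm⟩ := exists_nat_one_div_lt hz
      refine ⟨1 + ∑ n ∈ Finset.range m, |A n|, ?_⟩
      have hopen : ∀ᶠ y : ({p}ᶜ : Set X) in 𝓝 z, 1 / ((m : ℝ) + 1) < dist (y : X) p :=
        (continuous_subtype_val.dist continuous_const).continuousAt.eventually (lt_mem_nhds hm)
      filter_upwards [hopen] with y hy
      refine ⟨by linarith [Finset.sum_nonneg fun n (_ : n ∈ Finset.range m) => abs_nonneg (A n)],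
        fun n hn => ?_⟩
      have hnm : n < m := by
        by_contra! h
        have : 1 / ((n : ℝ) + 1) ≤ 1 / ((m : ℝ) + 1) := by gcongr
        linarith
      have := Finset.single_le_sum (f := fun n => |A n|) (fun n _ => abs_nonneg (A n))
        (Finset.mem_range.2 hnm)
      linarith [le_abs_self (A n)])
  exact ⟨g, g.continuous, fun z => (hg z).1, fun n z => (hg z).2 n⟩

/-- If all orbits return to every neighborhood of a fixed point within bounded time, then a
suitable clock runs at an unbounded rate on long orbit segments. -/
theorem exists_slow_rate (hp : IsFixedPoint φ p)
    (hrec : ∀ U ∈ 𝓝 p, ∃ N : ℝ, ∀ x, ∃ t ∈ Icc 0 N, φ t x ∈ U) :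
    ∃ w : ({p}ᶜ : Set X) → ℝ, Continuous w ∧ (∀ z, 1 ≤ w z) ∧
      ∀ n : ℕ, ∃ M > 0, ∀ z, n * M ≤ clock (awayFlow φ hp) w z M := by
  have hU : ∀ n : ℕ, ∃ N : ℝ, 0 ≤ N ∧ ∀ x, ∃ t ∈ Icc 0 N, ∀ s ∈ Icc (0 : ℝ) 1,
      dist (φ s (φ t x)) p ≤ 1 / (n + 1) := by
    intro n
    have hev := (isCompact_Icc (a := (0 : ℝ)) (b := 1)).eventually_forall_of_forall_eventually
      (P := fun y s => dist (φ s y) p ≤ 1 / (n + 1)) (x₀ := p) fun s _ => by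
        have hc : ContinuousAt (fun q : X × ℝ => dist (φ q.2 q.1) p) (p, s) :=
          ((φ.continuous continuous_snd continuous_fst).dist continuous_const).continuousAt
        refine hc.eventually (ge_mem_nhds ?_)
        change dist (φ s p) p < _
        rw [hp s, dist_self]
        positivity
    obtain ⟨N, hN⟩ := hrec _ hev
    obtain ⟨t, ht, -⟩ := hN p
    exact ⟨N, ht.1.trans ht.2, hN⟩
  choose N hN0 hN using hU
  -- Every orbit segment of length `N n + 1` contains a unit of time within `1 / (n + 1)` of `p`.
  -- The rate `n * (N n + 1)` there makes this unit alone pay for the whole segment.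
  obtain ⟨w, hw, hw1, hwA⟩ := exists_rate p fun n => n * (N n + 1)
  refine ⟨w, hw, hw1, fun n => ⟨N n + 1, by linarith [hN0 n], fun z => ?_⟩⟩
  obtain ⟨t, ht, hts⟩ := hN n z
  have h1 : (n * (N n + 1) : ℝ) ≤ clock (awayFlow φ hp) w (awayFlow φ hp t z) 1 := by
    have := intervalIntegral.integral_mono_on (μ := MeasureTheory.volume) zero_le_one
      ((continuous_const (y := (n * (N n + 1) : ℝ))).intervalIntegrable 0 1)
      ((continuous_rate (φ := awayFlow φ hp) hw (awayFlow φ hp t z)).intervalIntegrable 0 1)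
      fun s hs => hwA n _ (hts s hs)
    simpa [clock] using this
  have h2 := clock_add (φ := awayFlow φ hp) hw z t 1
  have h3 := le_clock (φ := awayFlow φ hp) hw hw1 z ht.1
  have h4 := (clock_strictMono (φ := awayFlow φ hp) hw hw1 z).monotone
    (show t + 1 ≤ N n + 1 by linarith [ht.2])
  linarith [ht.1]

/-- The flow `ψ` spends only a small proportion of the integer times away from `p`. -/
def MostlyNear (ψ : Flow ℝ X) (p : X) : Prop :=
  ∀ δ > 0, ∀ η > 0, ∃ C : ℝ, ∀ (x : X) (m : ℕ),
    (((Finset.range m).filter fun k : ℕ => δ ≤ dist (ψ k x) p).card : ℝ) ≤ η * m + C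

variable [CompactSpace X] {w : ({p}ᶜ : Set X) → ℝ}

theorem exists_pos_le_away {f : ({p}ᶜ : Set X) → ℝ} (hf : Continuous f) (hpos : ∀ z, 0 < f z)
    {δ : ℝ} (hδ : 0 < δ) : ∃ c > 0, ∀ z : ({p}ᶜ : Set X), δ ≤ dist (z : X) p → c ≤ f z := by
  have hK : IsCompact {z : ({p}ᶜ : Set X) | δ ≤ dist (z : X) p} := by
    rw [IsEmbedding.subtypeVal.isCompact_iff]
    have : ((↑) : ({p}ᶜ : Set X) → X) '' {z | δ ≤ dist (z : X) p} = {x | δ ≤ dist x p} := by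
      ext x
      constructor
      · rintro ⟨z, hz, rfl⟩
        exact hz
      · intro hx
        refine ⟨⟨x, fun h => ?_⟩, hx, rfl⟩
        rw [mem_singleton_iff] at h
        subst h
        simp only [mem_ofPred_eq, dist_self] at hx
        linarith
    rw [this]
    exact (isClosed_le continuous_const (continuous_id.dist continuous_const)).isCompact
  rcases Set.eq_empty_or_nonempty {z : ({p}ᶜ : Set X) | δ ≤ dist (z : X) p} with h | h
  · exact ⟨1, one_pos, fun z hz => absurd hz (Set.eq_empty_iff_forall_notMem.1 h z)⟩
  · obtain ⟨z₀, -, hz₀⟩ := hK.exists_isMinOn h hf.continuousOn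
    exact ⟨f z₀, hpos z₀, fun z hz => isMinOn_iff.1 hz₀ z hz⟩

theorem mostlyNear_slowFlow (hp : IsFixedPoint φ p) (hw : Continuous w) (hw1 : ∀ z, 1 ≤ w z)
    (hslow : ∀ n : ℕ, ∃ M > 0, ∀ z, n * M ≤ clock (awayFlow φ hp) w z M) :
    MostlyNear (slowFlow φ hp hw hw1) p := by
  intro δ hδ η hη
  obtain ⟨c, hc, hcδ⟩ := exists_pos_le_away
    (continuous_unclock_left (φ := awayFlow φ hp) hw hw1 1)
    (fun z => unclock_pos (φ := awayFlow φ hp) hw hw1 z one_pos) hδ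
  -- Each integer clock time away from `p` starts a unit step that uses at least `c` of original
  -- time, so the tolerance is scaled by `c` and divided by it at the end.
  obtain ⟨C, hC⟩ := exists_unclock_le hw hw1 hslow (mul_pos hη hc)
  refine ⟨|C| / c, fun x m => ?_⟩
  by_cases h : x = p
  · subst h
    have : ((Finset.range m).filter fun k : ℕ => δ ≤ dist (slowFlow φ hp hw hw1 k x) x) = ∅ := by
      refine Finset.filter_eq_empty_iff.2 fun k _ => ?_
      rw [slowFlow_fixedPoint, dist_self]
      exact not_le.2 hδ
    rw [this]
    simp only [Finset.card_empty, Nat.cast_zero]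
    positivity
  · obtain ⟨z, rfl⟩ : ∃ z : ({p}ᶜ : Set X), (z : X) = x := ⟨⟨x, h⟩, rfl⟩
    have h1 := hC z m (Nat.cast_nonneg m)
    have h2 := card_mul_le_unclock hw hw1 (fun z : ({p}ᶜ : Set X) => δ ≤ dist (z : X) p) hcδ z m
    simp only [slowFlow_coe]
    refine le_of_mul_le_mul_right (h2.trans (h1.trans ?_)) hc
    rw [add_mul, div_mul_cancel₀ _ hc.ne']
    linarith [le_abs_self C]

end Rate

/-! ### Entropy -/

section Entropy

theorem partNumber_le {X S : Type*} [Fintype S] {d : X → X → ℝ} {ε : ℝ} (f : X → S)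
    (hf : ∀ x y, f x = f y → d x y ≤ ε) : partNumber d ε ≤ Fintype.card S :=
  sInf_le ⟨Fintype.card S, rfl, fun x => Fintype.equivFin S (f x), fun x y hxy =>
    hf x y ((Fintype.equivFin S).injective hxy)⟩

theorem one_le_partNumber {X : Type*} [Nonempty X] (d : X → X → ℝ) (ε : ℝ) :
    1 ≤ partNumber d ε := by
  refine le_sInf ?_
  rintro m ⟨n, rfl, f, -⟩
  have := (f (Classical.arbitrary X)).pos
  exact_mod_cast this

/-- Codes of length `m` over an alphabet of `K` letters and a blank, with at most `q` letters. -/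
abbrev SparseCode (m K : ℕ) (q : ℝ) : Type :=
  {c : Fin m → Option (Fin K) // ((Finset.univ.filter fun i => c i ≠ none).card : ℝ) ≤ q}

noncomputable instance (m K : ℕ) (q : ℝ) : Fintype (SparseCode m K q) := Fintype.ofFinite _

/-- Give each code the weight `l` to the number of its letters. The weights of all codes sum to `(1
+ l * K) ^ m ≤ exp (m * l * K)`, while a sparse code weighs at least `l ^ q`. -/
theorem log_card_sparseCode_le (m K : ℕ) {q l : ℝ} (hq : 0 ≤ q) (hl : 0 < l) (hl1 : l ≤ 1) :
    Real.log (Fintype.card (SparseCode m K q)) ≤ q * Real.log (1 / l) + m * (l * K) := by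
  have hlog : 0 ≤ Real.log (1 / l) := Real.log_nonneg ((one_le_div hl).2 hl1)
  rcases Nat.eq_zero_or_pos (Fintype.card (SparseCode m K q)) with h0 | hpos
  · rw [h0, Nat.cast_zero, Real.log_zero]
    positivity
  · have hsum : (1 + l * K) ^ m = ∑ c : Fin m → Option (Fin K),
        l ^ (Finset.univ.filter fun i => c i ≠ none).card := by
      have h := Fintype.sum_pow (fun a : Option (Fin K) => if a ≠ none then l else 1) m
      rw [Fintype.sum_option] at h
      simp only [ne_eq, not_true_eq_false, if_false, reduceCtorEq, not_false_eq_true, if_true,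
        Finset.sum_const, Finset.card_univ, Fintype.card_fin, nsmul_eq_mul] at h
      rw [mul_comm l, h]
      refine Finset.sum_congr rfl fun c _ => ?_
      rw [Finset.prod_ite]
      simp
    have hle : (Fintype.card (SparseCode m K q) : ℝ) * l ^ q ≤ (1 + l * K) ^ m := by
      rw [hsum, ← nsmul_eq_mul, ← Finset.card_univ, ← Finset.sum_const]
      calc ∑ _c : SparseCode m K q, l ^ q
          ≤ ∑ c : SparseCode m K q, l ^ (Finset.univ.filter fun i => c.1 i ≠ none).card := by
            refine Finset.sum_le_sum fun c _ => ?_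
            rw [← Real.rpow_natCast]
            exact Real.rpow_le_rpow_of_exponent_ge hl hl1 c.2
        _ = ∑ c ∈ (Finset.univ : Finset (SparseCode m K q)).map (Function.Embedding.subtype _),
              l ^ (Finset.univ.filter fun i => (c : Fin m → Option (Fin K)) i ≠ none).card := by
            rw [Finset.sum_map]
            rfl
        _ ≤ _ := Finset.sum_le_sum_of_subset_of_nonneg (Finset.subset_univ _)
            fun c _ _ => by positivity
    have hexp : (1 + l * K) ^ m ≤ Real.exp (m * (l * K)) := by
      rw [Real.exp_nat_mul]
      gcongr
      rw [add_comm]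
      exact Real.add_one_le_exp _
    have hcard : (0 : ℝ) < Fintype.card (SparseCode m K q) := by exact_mod_cast hpos
    have := Real.log_le_log (by positivity) (hle.trans hexp)
    rw [Real.log_exp, Real.log_mul hcard.ne' (Real.rpow_pos_of_pos hl q).ne',
      Real.log_rpow hl] at this
    rw [one_div, Real.log_inv]
    linarith

theorem log_partNumber_div_le {X : Type*} {d : X → X → ℝ} {ε γ r : ℝ} {n : ℕ} (hn : 0 < n)
    (h : partNumber d ε ≤ n) (hr : 0 < r) (hlog : Real.log n ≤ γ * r) :
    ENNReal.log (partNumber d ε : ℝ≥0∞) / (r : EReal) ≤ γ := by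
  have h1 : ENNReal.log (partNumber d ε : ℝ≥0∞) ≤ (Real.log n : ℝ) := by
    have h2 : (partNumber d ε : ℝ≥0∞) ≤ ENNReal.ofReal n := by
      rw [ENNReal.ofReal_natCast]
      exact_mod_cast ENat.toENNReal_mono h
    refine (ENNReal.log_le_log h2).trans ?_
    rw [ENNReal.log_ofReal_of_pos (by exact_mod_cast hn)]
  refine (EReal.div_le_div_right_of_nonneg (by exact_mod_cast hr.le)
    (h1.trans (EReal.coe_le_coe_iff.2 hlog))).trans ?_
  rw [← EReal.coe_div, mul_div_cancel_right₀ _ hr.ne']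

variable {X : Type*} [MetricSpace X] (ψ : Flow ℝ X) {p : X}

theorem exists_stay_near (hp : IsFixedPoint ψ p) {ε : ℝ} (hε : 0 < ε) :
    ∃ δ > 0, ∀ x, dist x p < δ → ∀ t ∈ Icc (0 : ℝ) 1, dist (ψ t x) p ≤ ε := by
  have hev := (isCompact_Icc (a := (0 : ℝ)) (b := 1)).eventually_forall_of_forall_eventually
    (P := fun y s => dist (ψ s y) p ≤ ε) (x₀ := p) fun s _ => by
      have hc : ContinuousAt (fun q : X × ℝ => dist (ψ q.2 q.1) p) (p, s) :=
        ((ψ.continuous continuous_snd continuous_fst).dist continuous_const).continuousAt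
      refine hc.eventually (ge_mem_nhds ?_)
      change dist (ψ s p) p < _
      rwa [hp s, dist_self]
  exact Metric.eventually_nhds_iff.1 hev

/-- A point is coded by its positions at integer times: blank if near `p`, otherwise its class under
`f`. Equal symbols control the next unit of time: by hypothesis on `f` for letters, and through `p`
with `ε / 2 + ε / 2` for blanks. -/
theorem partNumber_le_card_sparseCode {ε δ : ℝ}
    (hδ : ∀ x, dist x p < δ → ∀ t ∈ Icc (0 : ℝ) 1, dist (ψ t x) p ≤ ε / 2)
    {K : ℕ} {f : X → Fin K} (hf : ∀ x y, f x = f y → ∀ t ∈ Icc (0 : ℝ) 1,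
      dist (ψ t x) (ψ t y) ≤ ε) {m : ℕ} {q : ℝ}
    (hq : ∀ x, (((Finset.range m).filter fun k : ℕ => δ ≤ dist (ψ k x) p).card : ℝ) ≤ q)
    {r : ℝ} (hr : 0 ≤ r) (hrm : r < m) :
    partNumber (bowenDist ψ (Icc 0 r)) ε ≤ Fintype.card (SparseCode m K q) := by
  classical
  let code : X → Fin m → Option (Fin K) := fun x k =>
    if dist (ψ (k : ℕ) x) p < δ then none else some (f (ψ (k : ℕ) x))
  have hcode : ∀ x, ((Finset.univ.filter fun k => code x k ≠ none).card : ℝ) ≤ q := by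
    intro x
    refine le_trans ?_ (hq x)
    norm_cast
    refine Finset.card_le_card_of_injOn (fun k : Fin m => (k : ℕ)) (fun k hk => ?_)
      Fin.val_injective.injOn
    simpa [code] using hk
  refine partNumber_le (fun x => (⟨code x, hcode x⟩ : SparseCode m K q)) fun x y hxy => ?_
  have hxy : code x = code y := congrArg Subtype.val hxy
  have : Nonempty (Icc 0 r) := ⟨⟨0, le_rfl, hr⟩⟩
  refine ciSup_le fun ⟨t, ht0, htr⟩ => ?_
  set k := ⌊t⌋₊
  have hk : k < m := by
    rw [Nat.floor_lt ht0]
    exact htr.trans_lt hrm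
  have htk : t - k ∈ Icc (0 : ℝ) 1 :=
    ⟨sub_nonneg.2 (Nat.floor_le ht0), by linarith [Nat.lt_floor_add_one t]⟩
  have hsplit : ∀ z, ψ t z = ψ (t - k) (ψ k z) := fun z => by rw [← ψ.map_add, sub_add_cancel]
  have h := congrFun hxy ⟨k, hk⟩
  simp only [hsplit]
  by_cases hx : dist (ψ k x) p < δ <;> by_cases hy : dist (ψ k y) p < δ
  · have h1 := hδ _ hx _ htk
    have h2 := hδ _ hy _ htk
    linarith [dist_triangle_right (ψ (t - k) (ψ k x)) (ψ (t - k) (ψ k y)) p]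
  · simp [code, hx, hy] at h
  · simp [code, hx, hy] at h
  · simp only [code, hx, hy, if_false, Option.some.injEq] at h
    exact hf _ _ h _ htk

variable [CompactSpace X]

/-- A finite partition into sets whose points stay close during a unit of time. -/
theorem exists_finite_partition {ε : ℝ} (hε : 0 < ε) :
    ∃ (K : ℕ) (f : X → Fin K), ∀ x y, f x = f y → ∀ t ∈ Icc (0 : ℝ) 1,
      dist (ψ t x) (ψ t y) ≤ ε := by
  have hloc : ∀ z : X, ∃ U ∈ 𝓝 z, ∀ x ∈ U, ∀ y ∈ U, ∀ t ∈ Icc (0 : ℝ) 1,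
      dist (ψ t x) (ψ t y) ≤ ε := by
    intro z
    have hev := (isCompact_Icc (a := (0 : ℝ)) (b := 1)).eventually_forall_of_forall_eventually
      (P := fun y s => dist (ψ s y) (ψ s z) ≤ ε / 2) (x₀ := z) fun s _ => by
        have hc : ContinuousAt (fun q : X × ℝ => dist (ψ q.2 q.1) (ψ q.2 z)) (z, s) :=
          ((ψ.continuous continuous_snd continuous_fst).dist
            (ψ.continuous continuous_snd continuous_const)).continuousAt
        refine hc.eventually (ge_mem_nhds ?_)
        change dist (ψ s z) (ψ s z) < _
        rw [dist_self]
        positivity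
    refine ⟨_, hev, fun x hx y hy t ht => ?_⟩
    have h1 := hx t ht
    have h2 := hy t ht
    linarith [dist_triangle_right (ψ t x) (ψ t y) (ψ t z)]
  choose U hU hUd using hloc
  obtain ⟨s, hs⟩ := CompactSpace.elim_nhds_subcover U hU
  have hmem : ∀ x, ∃ z : s, x ∈ U z := fun x => by
    have : x ∈ ⋃ z ∈ s, U z := hs ▸ mem_univ x
    simpa using this
  choose g hg using hmem
  refine ⟨Fintype.card s, fun x => Fintype.equivFin s (g x), fun x y hxy => ?_⟩
  have hxy : g x = g y := (Fintype.equivFin s).injective hxy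
  exact hUd (g x) x (hg x) y (hxy ▸ hg y)

/-- A flow that spends most of the time near a fixed point has zero entropy. -/
theorem topEntropy_eq_zero (hp : IsFixedPoint ψ p) (hnear : MostlyNear ψ p) :
    topEntropy ψ = 0 := by
  have hX : Nonempty X := ⟨p⟩
  apply le_antisymm
  · refine iSup₂_le fun ε hε => EReal.le_of_forall_lt_iff_le.1 fun γ hγ => ?_
    have hγ : 0 < γ := by exact_mod_cast hγ
    obtain ⟨δ, hδ, hδp⟩ := exists_stay_near ψ hp (half_pos hε)
    obtain ⟨K, f, hf⟩ := exists_finite_partition ψ hε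
    -- The choices of `l` and `η` make `l * K` and `η * Λ` at most `γ / 4`. The logarithm is then at
    -- most `(r + 1) * γ / 2 + |C| * Λ`, which is at most `γ * r` once `r ≥ 1 + 2 * |C| * Λ / γ`.
    set l : ℝ := min 1 (γ / (4 * (K + 1)))
    have hl : 0 < l := lt_min one_pos (by positivity)
    have hl1 : l ≤ 1 := min_le_left _ _
    have hlK : l * K ≤ γ / 4 := by
      have h1 : l ≤ γ / (4 * (K + 1)) := min_le_right _ _
      rw [le_div_iff₀ (by positivity)] at h1
      nlinarith
    set Λ := Real.log (1 / l)
    have hΛ : 0 ≤ Λ := Real.log_nonneg ((one_le_div hl).2 hl1)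
    set η := γ / (4 * (Λ + 1))
    have hη : 0 < η := by positivity
    have hηΛ : η * Λ ≤ γ / 4 := by
      have : η * (4 * (Λ + 1)) = γ := div_mul_cancel₀ _ (by positivity)
      nlinarith
    obtain ⟨C, hC⟩ := hnear δ hδ η hη
    refine limsup_le_of_le isCobounded_le_of_bot ?_
    filter_upwards [eventually_gt_atTop 0, eventually_ge_atTop (1 + 2 * (|C| * Λ) / γ)]
      with r hr0 hr
    set m := ⌊r⌋₊ + 1
    have hrm : r < m := by
      simp only [m]
      exact_mod_cast Nat.lt_floor_add_one r
    have hmr : (m : ℝ) ≤ r + 1 := by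
      simp only [m]
      push_cast
      linarith [Nat.floor_le hr0.le]
    have hpart := partNumber_le_card_sparseCode ψ hδp hf
      (q := η * m + |C|) (fun x => (hC x m).trans (by linarith [le_abs_self C])) hr0.le hrm
    refine log_partNumber_div_le ?_ hpart hr0 ?_
    · have := (one_le_partNumber _ _).trans hpart
      exact_mod_cast this
    · refine (log_card_sparseCode_le m K (by positivity) hl hl1).trans ?_
      have h1 : 2 * (|C| * Λ) ≤ (r - 1) * γ := by
        rw [← div_le_iff₀ hγ]
        linarith
      have h2 : (m : ℝ) * (η * Λ) ≤ (r + 1) * (γ / 4) := by gcongr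
      have h3 : (m : ℝ) * (l * K) ≤ (r + 1) * (γ / 4) := by gcongr
      change (η * m + |C|) * Λ + m * (l * K) ≤ γ * r
      nlinarith
  · refine le_iSup₂_of_le 1 one_pos (le_limsup_of_frequently_le'
      (Eventually.frequently ?_))
    filter_upwards [eventually_ge_atTop 0] with r hr
    refine EReal.div_nonneg (ENNReal.zero_le_log_iff.2 ?_) (by exact_mod_cast hr)
    exact_mod_cast ENat.toENNReal_mono (one_le_partNumber _ _)

end Entropy

end FlowComplexity

/-! ### Lipschitz functions with long gaps -/

namespace FlowComplexity

/-- The `1`-Lipschitz functions `ℝ → [0, 1]` such that every interval of length `8 ^ (n + 1) + n`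
contains an interval of length `n + 1` on which the function vanishes. -/
def gapFunctions : Set (ℝ → ℝ) :=
  {f | (∀ t, f t ∈ Icc (0 : ℝ) 1) ∧ (∀ s t, |f s - f t| ≤ |s - t|) ∧
    ∀ (n : ℕ) (c : ℝ), ∃ j : ℕ, j < 8 ^ (n + 1) ∧ ∀ t ∈ Icc (c + j) (c + j + (n + 1)), f t = 0}

/-- All conditions are closed in a Tychonoff cube; for the gaps, because `j` ranges over a finite
set and a finite union of closed sets is closed. -/
theorem isCompact_gapFunctions : IsCompact gapFunctions := by
  refine IsCompact.of_isClosed_subset (isCompact_univ_pi fun _ : ℝ => isCompact_Icc)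
    ?_ (fun f hf t _ => hf.1 t)
  have h1 : IsClosed {f : ℝ → ℝ | ∀ t, f t ∈ Icc (0 : ℝ) 1} := by
    rw [ofPred_forall]
    exact isClosed_iInter fun t => isClosed_Icc.preimage (continuous_apply t)
  have h2 : IsClosed {f : ℝ → ℝ | ∀ s t, |f s - f t| ≤ |s - t|} := by
    simp only [ofPred_forall]
    exact isClosed_iInter fun s => isClosed_iInter fun t =>
      isClosed_le ((continuous_apply s).sub (continuous_apply t)).abs continuous_const
  have h3 : IsClosed {f : ℝ → ℝ | ∀ (n : ℕ) (c : ℝ), ∃ j : ℕ, j < 8 ^ (n + 1) ∧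
      ∀ t ∈ Icc (c + j) (c + j + (n + 1)), f t = 0} := by
    simp only [ofPred_forall]
    refine isClosed_iInter fun n => isClosed_iInter fun c => ?_
    have : {f : ℝ → ℝ | ∃ j : ℕ, j < 8 ^ (n + 1) ∧ ∀ t ∈ Icc (c + j) (c + j + (n + 1)), f t = 0} =
        ⋃ j ∈ Finset.range (8 ^ (n + 1)),
          {f : ℝ → ℝ | ∀ t ∈ Icc (c + j) (c + j + (n + 1)), f t = 0} := by
      ext f
      simp
    rw [this]
    refine isClosed_biUnion_finset fun j _ => ?_
    simp only [ofPred_forall]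
    exact isClosed_iInter fun t => isClosed_iInter fun _ =>
      isClosed_eq (continuous_apply t) continuous_const
  exact h1.inter (h2.inter h3)

/-- The space of `gapFunctions` with the topology of pointwise convergence. -/
abbrev GapSpace : Type := gapFunctions

instance : CompactSpace GapSpace := isCompact_iff_compactSpace.1 isCompact_gapFunctions

theorem GapSpace.abs_sub_le (f : GapSpace) (s t : ℝ) : |f.1 s - f.1 t| ≤ |s - t| := f.2.2.1 s t

/-- The common Lipschitz constant upgrades pointwise convergence to joint continuity in function and
time. -/
theorem continuous_eval : Continuous fun q : GapSpace × ℝ => q.1.1 q.2 := by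
  refine continuous_iff_continuousAt.2 ?_
  rintro ⟨f, s⟩
  rw [ContinuousAt, tendsto_iff_dist_tendsto_zero]
  have hlim : Tendsto (fun q : GapSpace × ℝ => |q.2 - s| + |q.1.1 s - f.1 s|) (𝓝 (f, s))
      (𝓝 0) := by
    have hc : Continuous fun q : GapSpace × ℝ => |q.2 - s| + |q.1.1 s - f.1 s| := by
      have : Continuous fun q : GapSpace × ℝ => q.1.1 s :=
        (continuous_apply s).comp (continuous_subtype_val.comp continuous_fst)
      fun_prop
    have := hc.tendsto (f, s)
    simpa using this
  refine squeeze_zero (fun _ => dist_nonneg) (fun q => ?_) hlim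
  rw [Real.dist_eq]
  have h1 := q.1.abs_sub_le q.2 s
  have h2 := abs_sub_le (q.1.1 q.2) (q.1.1 s) (f.1 s)
  change |q.1.1 q.2 - f.1 s| ≤ _
  linarith

/-- Continuous functions are determined by their values at rationals, so the compact space embeds in
a countable product of lines. -/
instance : TopologicalSpace.MetrizableSpace GapSpace := by
  have hc : Continuous fun (f : GapSpace) (q : ℚ) => f.1 q :=
    continuous_pi fun q => (continuous_apply (q : ℝ)).comp continuous_subtype_val
  refine (hc.isClosedEmbedding fun f g hfg => ?_).isEmbedding.metrizableSpace
  have hcont : ∀ f : GapSpace, Continuous f.1 := fun f =>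
    continuous_eval.comp (Continuous.prodMk_right f)
  exact Subtype.ext (Rat.denseRange_cast.equalizer (hcont f) (hcont g) hfg)

noncomputable instance : MetricSpace GapSpace := TopologicalSpace.metrizableSpaceMetric GapSpace

/-- The shift flow on the space of `gapFunctions`. -/
noncomputable def shiftFlow : Flow ℝ GapSpace where
  toFun t f := ⟨fun s => f.1 (s + t), fun s => f.2.1 _, fun s s' => by
      simpa using f.abs_sub_le (s + t) (s' + t), fun n c => by
      obtain ⟨j, hj, h⟩ := f.2.2.2 n (c + t)
      exact ⟨j, hj, fun s hs => h _ ⟨by linarith [hs.1], by linarith [hs.2]⟩⟩⟩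
  cont' := by
    refine Continuous.subtype_mk (continuous_pi fun s => ?_) _
    exact continuous_eval.comp
      (continuous_snd.prodMk (continuous_const.add continuous_fst))
  map_add' t₁ t₂ f := Subtype.ext (funext fun s => congrArg f.1 (by ring))
  map_zero' f := Subtype.ext (funext fun s => congrArg f.1 (by ring))

theorem shiftFlow_apply (t : ℝ) (f : GapSpace) (s : ℝ) : (shiftFlow t f).1 s = f.1 (s + t) := rfl

/-- The zero function. -/
noncomputable def zeroFunction : GapSpace :=
  ⟨fun _ => 0, fun _ => ⟨le_rfl, zero_le_one⟩, fun s t => by simp,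
    fun n _ => ⟨0, by positivity, fun _ _ => rfl⟩⟩

theorem isFixedPoint_zeroFunction : IsFixedPoint shiftFlow zeroFunction := fun _ => rfl

theorem shiftFlow_recurrent (U : Set GapSpace) (hU : U ∈ 𝓝 zeroFunction) :
    ∃ N : ℝ, ∀ f, ∃ t ∈ Icc 0 N, shiftFlow t f ∈ U := by
  rw [nhds_subtype_eq_comap, mem_comap] at hU
  obtain ⟨V, hV, hVU⟩ := hU
  rw [nhds_pi, Filter.mem_pi] at hV
  obtain ⟨F, hF, W, hW, hWV⟩ := hV
  obtain ⟨R, hR⟩ := (hF.image abs).bddAbove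
  obtain ⟨n, hn⟩ := exists_nat_ge (max R 0)
  have hR : ∀ s ∈ F, |s| ≤ n := fun s hs => (hR ⟨s, hs, rfl⟩).trans ((le_max_left _ _).trans hn)
  refine ⟨8 ^ (2 * n + 1) + n, fun f => ?_⟩
  -- The neighborhood restricts values only at finitely many points of `[-n, n]`. A gap of level `2
  -- * n` has length `2 * n + 1`, and shifting by `j + n` places it over `[-n, n]`.
  obtain ⟨j, hj, h⟩ := f.2.2.2 (2 * n) 0
  refine ⟨j + n, ⟨by positivity, ?_⟩, hVU (hWV fun s hs => ?_)⟩
  · have : (j : ℝ) ≤ 8 ^ (2 * n + 1) := by exact_mod_cast hj.le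
    linarith
  · have hs' := abs_le.1 (hR s hs)
    rw [shiftFlow_apply, h]
    · exact mem_of_mem_nhds (hW s)
    · push_cast
      exact ⟨by linarith [hs'.1], by linarith [hs'.2]⟩

/-! ### Cubes of bump functions -/

/-- The function with bumps of radius `h` and heights `u i * h` at the points `c i`. -/
noncomputable def bumps {N : ℕ} (c : Fin N → ℝ) (h : ℝ) (u : Fin N → unitInterval) (t : ℝ) : ℝ :=
  ⨆ i, (u i : ℝ) * max 0 (h - |t - c i|)

section Bumps

variable {N : ℕ} {c : Fin N → ℝ} {h : ℝ} (u : Fin N → unitInterval)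

theorem le_bumps (t : ℝ) (i : Fin N) : (u i : ℝ) * max 0 (h - |t - c i|) ≤ bumps c h u t :=
  le_ciSup (f := fun i => (u i : ℝ) * max 0 (h - |t - c i|)) (Set.finite_range _).bddAbove i

theorem bumps_nonneg (t : ℝ) : 0 ≤ bumps c h u t :=
  Real.iSup_nonneg fun i => mul_nonneg (u i).2.1 (le_max_left _ _)

theorem bumps_le (hh : 0 ≤ h) (t : ℝ) : bumps c h u t ≤ h := by
  refine Real.iSup_le (fun i => ?_) hh
  have h1 : max 0 (h - |t - c i|) ≤ h := max_le hh (by linarith [abs_nonneg (t - c i)])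
  exact (mul_le_of_le_one_left (le_max_left _ _) (u i).2.2).trans h1

theorem bumps_le_add (s t : ℝ) : bumps c h u s ≤ bumps c h u t + |s - t| := by
  refine Real.iSup_le (fun i => ?_) (add_nonneg (bumps_nonneg u t) (abs_nonneg _))
  have h1 : max 0 (h - |s - c i|) ≤ max 0 (h - |t - c i|) + |s - t| := by
    refine max_le (add_nonneg (le_max_left _ _) (abs_nonneg _)) ?_
    have h2 := abs_sub_le t s (c i)
    rw [abs_sub_comm t s] at h2
    have h3 := le_max_right 0 (h - |t - c i|)
    linarith
  have h4 := mul_le_mul_of_nonneg_left h1 (u i).2.1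
  have h5 : (u i : ℝ) * |s - t| ≤ |s - t| := mul_le_of_le_one_left (abs_nonneg _) (u i).2.2
  linarith [le_bumps (c := c) (h := h) u t i]

theorem abs_bumps_sub_le (s t : ℝ) : |bumps c h u s - bumps c h u t| ≤ |s - t| := by
  have h1 := bumps_le_add (c := c) (h := h) u s t
  have h2 := bumps_le_add (c := c) (h := h) u t s
  rw [abs_sub_comm t s] at h2
  exact abs_sub_le_iff.2 ⟨by linarith, by linarith⟩

theorem bumps_eq_zero {t : ℝ} (ht : ∀ i, h ≤ |t - c i|) : bumps c h u t = 0 := by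
  have : ∀ i, (u i : ℝ) * max 0 (h - |t - c i|) = 0 := fun i => by
    rw [max_eq_left (by linarith [ht i]), mul_zero]
  simp only [bumps, this]
  exact Real.iSup_const_zero

theorem bumps_center (hh : 0 ≤ h) (hc : ∀ i j, i ≠ j → h ≤ |c i - c j|) (i : Fin N) :
    bumps c h u (c i) = u i * h := by
  apply le_antisymm
  · refine Real.iSup_le (fun j => ?_) (mul_nonneg (u i).2.1 hh)
    by_cases hij : i = j
    · subst hij
      simp [hh]
    · rw [max_eq_left (by linarith [hc i j hij]), mul_zero]
      exact mul_nonneg (u i).2.1 hh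
  · simpa [hh] using le_bumps (c := c) (h := h) u (c i) i

theorem continuous_bumps (hh1 : h ≤ 1) (t : ℝ) :
    Continuous fun u => bumps c h u t := by
  refine (LipschitzWith.of_le_add fun u v => ?_).continuous
  refine Real.iSup_le (fun i => ?_) (add_nonneg (bumps_nonneg v t) dist_nonneg)
  have h1 : max 0 (h - |t - c i|) ≤ 1 := max_le zero_le_one (by linarith [abs_nonneg (t - c i)])
  have h2 : (u i : ℝ) - v i ≤ dist u v :=
    (le_abs_self _).trans (dist_le_pi_dist u v i)
  have h3 := le_bumps (c := c) (h := h) v t i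
  have h4 : ((u i : ℝ) - v i) * max 0 (h - |t - c i|) ≤ dist u v := by
    refine (mul_le_mul_of_nonneg_right h2 (le_max_left _ _)).trans ?_
    exact mul_le_of_le_one_right dist_nonneg h1
  linarith

end Bumps

/-! ### Places for the bumps -/

/-- The unit interval `[k, k + 1]` belongs to a gap. -/
def Blocked (k : ℤ) : Prop :=
  ∃ n : ℕ, 4 * 8 ^ n ≤ k % 8 ^ (n + 1) ∧ k % 8 ^ (n + 1) ≤ 4 * 8 ^ n + (n + 1)

/-- There are `n + 2` consecutive blocked intervals because a real interval of length `n + 1` may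
meet that many unit intervals. The number `j` is the distance to the next residue `4 * 8 ^ n`, and
`n < 8 ^ n` keeps the window below the modulus. -/
theorem exists_blocked (n : ℕ) (a : ℤ) :
    ∃ j : ℕ, j < 8 ^ (n + 1) ∧ ∀ i : ℤ, 0 ≤ i → i ≤ n + 1 → Blocked (a + (j : ℕ) + i) := by
  have hpow : (0 : ℤ) < 8 ^ (n + 1) := by positivity
  have hn : (n : ℤ) < 8 ^ n := by exact_mod_cast Nat.lt_pow_self (by norm_num)
  set b : ℤ := (4 * 8 ^ n - a) % 8 ^ (n + 1)
  have hb0 : 0 ≤ b := Int.emod_nonneg _ hpow.ne'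
  have hb1 : b < 8 ^ (n + 1) := Int.emod_lt_of_pos _ hpow
  refine ⟨b.toNat, ?_, fun i hi0 hi1 => ⟨n, ?_⟩⟩
  · zify
    rwa [Int.toNat_of_nonneg hb0]
  · have hmod : (a + (b.toNat : ℤ) + i) % 8 ^ (n + 1) = 4 * 8 ^ n + i := by
      rw [Int.toNat_of_nonneg hb0]
      have h1 : a + b + i ≡ 4 * 8 ^ n + i [ZMOD 8 ^ (n + 1)] := by
        have : a + b ≡ a + (4 * 8 ^ n - a) [ZMOD 8 ^ (n + 1)] :=
          (Int.mod_modEq _ _).add_left a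
        rw [add_sub_cancel] at this
        exact this.add_right i
      rw [h1.eq]
      refine Int.emod_eq_of_lt (by positivity) ?_
      rw [pow_succ]
      linarith
    rw [hmod]
    constructor <;> linarith

open Classical in
/-- The unit intervals in `[0, 8 ^ m]` that do not belong to a gap. -/
noncomputable def freeIntervals (m : ℕ) : Finset ℤ := (Finset.Ico 0 (8 ^ m)).filter fun k => ¬ Blocked k

theorem mem_freeIntervals {m : ℕ} {k : ℤ} :
    k ∈ freeIntervals m ↔ 0 ≤ k ∧ k < 8 ^ m ∧ ¬ Blocked k := by
  simp [freeIntervals, and_assoc]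

/-- Closed form of the total gap length: the density of the gaps is at most `∑ (n + 2) / 8 ^ (n + 1)
= 15 / 49`, which is below one half. -/
theorem sum_gap_lengths (m : ℕ) :
    49 * ∑ n ∈ Finset.range m, (n + 2) * 8 ^ (m - (n + 1)) + (7 * m + 15) = 15 * 8 ^ m := by
  induction m with
  | zero => simp
  | succ m ih =>
    have : ∑ n ∈ Finset.range m, (n + 2) * 8 ^ (m + 1 - (n + 1)) =
        8 * ∑ n ∈ Finset.range m, (n + 2) * 8 ^ (m - (n + 1)) := by
      rw [Finset.mul_sum]
      refine Finset.sum_congr rfl fun n hn => ?_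
      have hn := Finset.mem_range.1 hn
      rw [show m + 1 - (n + 1) = m - (n + 1) + 1 by omega, pow_succ]
      ring
    rw [Finset.sum_range_succ, this, Nat.sub_self, pow_succ]
    omega

theorem card_window_le {m n : ℕ} (hn : n < m) :
    ((Finset.Ico (0 : ℤ) (8 ^ m)).filter fun k : ℤ =>
      4 * 8 ^ n ≤ k % 8 ^ (n + 1) ∧ k % 8 ^ (n + 1) ≤ 4 * 8 ^ n + (n + 1)).card ≤
      (n + 2) * 8 ^ (m - (n + 1)) := by
  have hpow : (0 : ℤ) < 8 ^ (n + 1) := by positivity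
  have hcard : (Finset.Icc (0 : ℤ) (n + 1) ×ˢ Finset.Ico (0 : ℤ) (8 ^ (m - (n + 1)))).card =
      (n + 2) * 8 ^ (m - (n + 1)) := by
    rw [Finset.card_product, Int.card_Icc, Int.card_Ico]
    congr 1
  rw [← hcard]
  refine Finset.card_le_card_of_injOn
    (fun k => (k % 8 ^ (n + 1) - 4 * 8 ^ n, k / 8 ^ (n + 1))) (fun k hk => ?_) ?_
  · simp only [Finset.coe_filter, Finset.mem_Ico, mem_ofPred_eq] at hk
    simp only [Finset.coe_product, Finset.coe_Icc, Finset.coe_Ico, mem_prod, mem_Icc, mem_Ico]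
    refine ⟨⟨by linarith, by linarith⟩, Int.ediv_nonneg hk.1.1 hpow.le,
      Int.ediv_lt_of_lt_mul hpow ?_⟩
    rw [← pow_add, Nat.sub_add_cancel hn]
    exact hk.1.2
  · intro k _ k' _ hkk
    simp only [Prod.mk.injEq] at hkk
    have h1 := Int.mul_ediv_add_emod k (8 ^ (n + 1))
    have h2 := Int.mul_ediv_add_emod k' (8 ^ (n + 1))
    rw [hkk.2] at h1
    linarith [hkk.1]

theorem le_card_freeIntervals (m : ℕ) : 8 ^ m ≤ 2 * (freeIntervals m).card := by
  classical
  have hsub : (Finset.Ico (0 : ℤ) (8 ^ m)).filter Blocked ⊆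
      (Finset.range m).biUnion fun n => (Finset.Ico (0 : ℤ) (8 ^ m)).filter fun k : ℤ =>
        4 * 8 ^ n ≤ k % 8 ^ (n + 1) ∧ k % 8 ^ (n + 1) ≤ 4 * 8 ^ n + (n + 1) := by
    intro k hk
    obtain ⟨hkI, n, hn⟩ := Finset.mem_filter.1 hk
    refine Finset.mem_biUnion.2 ⟨n, ?_, Finset.mem_filter.2 ⟨hkI, hn⟩⟩
    rw [Finset.mem_range]
    -- Levels `n ≥ m` do not affect `[0, 8 ^ m)`: there `k` is its own residue and lies below `4 * 8
    -- ^ n`.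
    by_contra! hmn
    obtain ⟨hk0, hk1⟩ := Finset.mem_Ico.1 hkI
    have h1 : (8 : ℤ) ^ m ≤ 8 ^ n := pow_le_pow_right₀ (by norm_num) hmn
    have h2 := hn.1
    rw [Int.emod_eq_of_lt hk0 (by rw [pow_succ]; linarith)] at h2
    linarith
  have h1 : ((Finset.Ico (0 : ℤ) (8 ^ m)).filter Blocked).card ≤
      ∑ n ∈ Finset.range m, (n + 2) * 8 ^ (m - (n + 1)) :=
    (Finset.card_le_card hsub).trans (Finset.card_biUnion_le.trans
      (Finset.sum_le_sum fun n hn => card_window_le (Finset.mem_range.1 hn)))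
  have h2 := Finset.card_filter_add_card_filter_not (s := Finset.Ico (0 : ℤ) (8 ^ m)) Blocked
  have h3 : (Finset.Ico (0 : ℤ) (8 ^ m)).card = 8 ^ m := by
    rw [Int.card_Ico]
    have : ((8 : ℤ) ^ m - 0) = ((8 ^ m : ℕ) : ℤ) := by
      push_cast
      ring
    rw [this, Int.toNat_natCast]
  have h4 := sum_gap_lengths m
  have h5 : (freeIntervals m).card = ((Finset.Ico (0 : ℤ) (8 ^ m)).filter fun k => ¬ Blocked k).card :=
    congrArg Finset.card (by ext; simp [freeIntervals])
  omega

/-- Many points in the free unit intervals which are far from each other and from the gaps. -/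
theorem exists_centers (m : ℕ) {q : ℕ} (hq : 0 < q) :
    ∃ (N : ℕ) (c : Fin N → ℝ), q * 8 ^ m ≤ N ∧ (∀ i, c i ∈ Icc (0 : ℝ) (8 ^ m)) ∧
      (∀ i j, i ≠ j → 1 / (4 * q : ℝ) ≤ |c i - c j|) ∧
      ∀ t : ℝ, Blocked ⌊t⌋ → ∀ i, 1 / (4 * q : ℝ) ≤ |t - c i| := by
  set h : ℝ := 1 / (4 * q : ℝ) with hdef
  have hq0 : (0 : ℝ) < q := by exact_mod_cast hq
  have hh : 0 < h := by positivity
  have hqh : 4 * q * h = 1 := by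
    rw [hdef]
    field_simp
  let I := freeIntervals m × Fin (2 * q)
  -- Each free unit interval receives `2 * q` centers at the odd multiples of `h`, so they are `2 *
  -- h` apart and `h` away from its ends. At least half of the intervals are free, which leaves at
  -- least `q * 8 ^ m` centers.
  let center : I → ℝ := fun i => (i.1 : ℤ) + (2 * (i.2 : ℕ) + 1) * h
  have hcard : Fintype.card I = (freeIntervals m).card * (2 * q) := by simp [I]
  have hbound : ∀ i : I, ((i.1 : ℤ) : ℝ) + h ≤ center i ∧ center i ≤ ((i.1 : ℤ) : ℝ) + 1 - h := by
    intro i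
    have h1 : ((i.2 : ℕ) : ℝ) + 1 ≤ 2 * q := by exact_mod_cast i.2.2
    have h2 : (0 : ℝ) ≤ (i.2 : ℕ) := Nat.cast_nonneg _
    simp only [center]
    constructor <;> nlinarith
  have hmem : ∀ i : I, 0 ≤ (i.1 : ℤ) ∧ (i.1 : ℤ) < 8 ^ m ∧ ¬ Blocked i.1 := by
    intro i
    exact mem_freeIntervals.1 i.1.2
  let e := (Fintype.equivFin I).symm
  refine ⟨Fintype.card I, fun i => center (e i), ?_, fun i => ?_, fun i j hij => ?_,
    fun t ht i => ?_⟩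
  · rw [hcard]
    nlinarith [le_card_freeIntervals m]
  · have h1 := hbound (e i)
    have h2 : (0 : ℝ) ≤ ((e i).1 : ℤ) := by exact_mod_cast (hmem (e i)).1
    have h3 : (((e i).1 : ℤ) : ℝ) + 1 ≤ 8 ^ m := by exact_mod_cast (hmem (e i)).2.1
    exact ⟨by linarith, by linarith⟩
  · set a := e i
    set b := e j
    have hab : a ≠ b := fun h => hij (e.injective h)
    -- As `1 = 2 * h * (2 * q)`, all differences of centers are integer multiples of `2 * h`.
    have hdiff : center a - center b =
        (2 * h) * (((2 * q * ((a.1 : ℤ) - b.1) + ((a.2 : ℕ) - (b.2 : ℕ) : ℤ)) : ℤ) : ℝ) := by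
      simp only [center]
      push_cast
      linear_combination (-((a.1 : ℤ) : ℝ) + ((b.1 : ℤ) : ℝ)) * hqh
    have hne : (2 * q * ((a.1 : ℤ) - b.1) + ((a.2 : ℕ) - (b.2 : ℕ) : ℤ)) ≠ 0 := by
      intro h0
      have ha := a.2.2
      have hb := b.2.2
      have h1 : (a.1 : ℤ) = b.1 := by
        by_contra hne
        rcases lt_or_gt_of_ne hne with hlt | hlt
        · have : (2 * q : ℤ) * ((a.1 : ℤ) - b.1) ≤ (2 * q : ℤ) * (-1) :=
            mul_le_mul_of_nonneg_left (by omega) (by positivity)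
          omega
        · have : (2 * q : ℤ) * 1 ≤ (2 * q : ℤ) * ((a.1 : ℤ) - b.1) :=
            mul_le_mul_of_nonneg_left (by omega) (by positivity)
          omega
      rw [h1, sub_self, mul_zero, zero_add] at h0
      exact hab (Prod.ext (Subtype.ext h1) (Fin.ext (by omega)))
    have h1 : (1 : ℝ) ≤ |(((2 * q * ((a.1 : ℤ) - b.1) + ((a.2 : ℕ) - (b.2 : ℕ) : ℤ)) : ℤ) : ℝ)| := by
      exact_mod_cast Int.one_le_abs hne
    change h ≤ |center a - center b|
    rw [hdiff, abs_mul, abs_of_pos (by positivity : 0 < 2 * h)]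
    nlinarith
  · have h1 := hbound (e i)
    have hne : ⌊t⌋ ≠ ((e i).1 : ℤ) := fun h => (hmem (e i)).2.2 (h ▸ ht)
    change h ≤ |t - center (e i)|
    rcases lt_or_gt_of_ne hne with hlt | hlt
    · have h2 : ((⌊t⌋ : ℤ) : ℝ) + 1 ≤ ((e i).1 : ℤ) := by exact_mod_cast hlt
      have h3 := Int.lt_floor_add_one t
      rw [abs_sub_comm]
      exact le_trans (by linarith) (le_abs_self _)
    · have h2 : (((e i).1 : ℤ) : ℝ) + 1 ≤ (⌊t⌋ : ℤ) := by exact_mod_cast hlt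
      have h3 := Int.floor_le t
      exact le_trans (by linarith) (le_abs_self _)

theorem bumps_mem_gapFunctions {N : ℕ} {c : Fin N → ℝ} {h : ℝ} (hh : 0 ≤ h) (hh1 : h ≤ 1)
    (hc : ∀ t : ℝ, Blocked ⌊t⌋ → ∀ i, h ≤ |t - c i|) (u : Fin N → unitInterval) :
    bumps c h u ∈ gapFunctions := by
  refine ⟨fun t => ⟨bumps_nonneg u t, (bumps_le u hh t).trans hh1⟩, abs_bumps_sub_le u,
    fun n a => ?_⟩
  obtain ⟨j, hj, hb⟩ := exists_blocked n ⌊a⌋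
  refine ⟨j, hj, fun t ht => bumps_eq_zero u (hc t ?_)⟩
  have h1 : ⌊a⌋ + (j : ℤ) ≤ ⌊t⌋ := by
    rw [Int.le_floor]
    push_cast
    linarith [ht.1, Int.floor_le a]
  have h2 : ⌊t⌋ < ⌊a⌋ + (j : ℤ) + (n + 2) := by
    rw [Int.floor_lt]
    push_cast
    linarith [ht.2, Int.lt_floor_add_one a]
  have := hb (⌊t⌋ - (⌊a⌋ + (j : ℤ))) (by omega) (by omega)
  rwa [add_sub_cancel] at this

/-! ### The mean dimension of the shift flow -/

theorem dist_le_bowenDist {X : Type*} [MetricSpace X] [CompactSpace X] (φ : Flow ℝ X) {F : Set ℝ}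
    {t : ℝ} (ht : t ∈ F) (x y : X) : dist (φ t x) (φ t y) ≤ bowenDist φ F x y := by
  refine le_ciSup (f := fun t : F => dist (φ t x) (φ t y)) ?_ ⟨t, ht⟩
  refine ⟨Metric.diam (univ : Set X), ?_⟩
  rintro _ ⟨s, rfl⟩
  exact Metric.dist_le_diam_of_mem isCompact_univ.isBounded (mem_univ _) (mem_univ _)

theorem exists_dist_lt_of_continuous {X : Type*} [MetricSpace X] [CompactSpace X] {g : X → ℝ}
    (hg : Continuous g) {r : ℝ} (hr : 0 < r) :
    ∃ ε > 0, ∀ ⦃x y⦄, dist x y < ε → dist (g x) (g y) < r :=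
  Metric.uniformContinuous_iff.1 (CompactSpace.uniformContinuous_of_continuous hg) r hr

/-- On opposite faces of the cube of bumps, the values at `c i` are `0` and `h`. Shifting by `c i`
brings them to the origin, where uniform continuity of evaluation provides an `ε` that depends on
`h`, hence on `q`, but not on `m`. -/
theorem exists_le_widim_shiftFlow {q : ℕ} (hq : 0 < q) :
    ∃ ε > 0, ∀ m : ℕ, ((q * 8 ^ m : ℕ) : ℕ∞) ≤
      widim (bowenDist shiftFlow (Icc 0 (8 ^ m))) ε := by
  set h : ℝ := 1 / (4 * q : ℝ)
  have hq1 : (1 : ℝ) ≤ q := by exact_mod_cast hq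
  have hh : 0 < h := by positivity
  have hh1 : h ≤ 1 := by
    rw [div_le_one (by positivity)]
    linarith
  have heval : Continuous fun f : GapSpace => f.1 0 :=
    (continuous_apply (0 : ℝ)).comp continuous_subtype_val
  obtain ⟨ε, hε, hεd⟩ := exists_dist_lt_of_continuous heval hh
  refine ⟨ε / 2, half_pos hε, fun m => ?_⟩
  obtain ⟨N, c, hN, hcI, hsep, hblock⟩ := exists_centers m hq
  refine le_trans (by exact_mod_cast hN) (le_widim
    (fun u => (⟨bumps c h u, bumps_mem_gapFunctions hh.le hh1 hblock u⟩ : GapSpace))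
    ((continuous_pi fun t => continuous_bumps hh1 t).subtype_mk _) fun i a b ha hb => ?_)
  refine lt_of_lt_of_le ?_ (dist_le_bowenDist shiftFlow (hcI i) _ _)
  by_contra! hle
  have := hεd (hle.trans_lt (half_lt_self hε))
  rw [shiftFlow_apply, shiftFlow_apply, zero_add] at this
  simp only [bumps_center _ hh.le hsep, ha, hb] at this
  simp [Real.dist_eq, abs_of_pos hh] at this

/-- A lower bound for a `limsup` needs only arbitrarily large times, here `r = 8 ^ m`. -/
theorem meanDim_shiftFlow : meanDim shiftFlow = ⊤ := by
  refine ENNReal.eq_top_of_forall_nnreal_le fun C => ?_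
  obtain ⟨q, hq⟩ := exists_nat_gt C
  have hq0 : 0 < q := by
    have : (0 : NNReal) < q := lt_of_le_of_lt (zero_le) hq
    exact_mod_cast this
  obtain ⟨ε, hε, hwidim⟩ := exists_le_widim_shiftFlow hq0
  refine le_iSup₂_of_le ε hε (le_limsup_of_frequently_le' ?_)
  rw [frequently_atTop]
  intro a
  obtain ⟨m, hm⟩ := pow_unbounded_of_one_lt a (by norm_num : (1 : ℝ) < 8)
  refine ⟨8 ^ m, hm.le, ?_⟩
  have hpos : ENNReal.ofReal (8 ^ m) ≠ 0 := by
    simp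
  rw [ENNReal.le_div_iff_mul_le (Or.inl hpos) (Or.inl ENNReal.ofReal_ne_top)]
  have h1 : ((q * 8 ^ m : ℕ) : ℝ≥0∞) ≤ (widim (bowenDist shiftFlow (Icc 0 (8 ^ m))) ε : ℝ≥0∞) := by
    exact_mod_cast ENat.toENNReal_mono (hwidim m)
  refine le_trans ?_ h1
  have h2 : ENNReal.ofReal (8 ^ m) = ((8 ^ m : ℕ) : ℝ≥0∞) := by
    rw [← ENNReal.ofReal_natCast]
    push_cast
    rfl
  rw [h2, Nat.cast_mul]
  gcongr
  exact_mod_cast hq.le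

end FlowComplexity

theorem mainTheorem3 :
    ∃ (X Y : Type) (_ : MetricSpace X) (_ : CompactSpace X) (_ : MetricSpace Y)
      (_ : CompactSpace Y) (φ : Flow ℝ X) (ψ : Flow ℝ Y),
      FlowComplexity.WeaklyEquivalent φ ψ ∧
      (∃ x : X, FlowComplexity.IsFixedPoint φ x) ∧
      (∃ y : Y, FlowComplexity.IsFixedPoint ψ y) ∧
      FlowComplexity.meanDim φ = ⊤ ∧
      FlowComplexity.topEntropy ψ = 0 := by
  obtain ⟨w, hw, hw1, hslow⟩ := FlowComplexity.exists_slow_rate FlowComplexity.shiftFlow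
    FlowComplexity.isFixedPoint_zeroFunction FlowComplexity.shiftFlow_recurrent
  have hfix := FlowComplexity.slowFlow_fixedPoint FlowComplexity.shiftFlow
    FlowComplexity.isFixedPoint_zeroFunction hw hw1
  exact ⟨FlowComplexity.GapSpace, FlowComplexity.GapSpace, inferInstance, inferInstance,
    inferInstance, inferInstance, FlowComplexity.shiftFlow, FlowComplexity.slowFlow _ _ hw hw1,
    FlowComplexity.weaklyEquivalent_slowFlow _ _ hw hw1,
    ⟨_, FlowComplexity.isFixedPoint_zeroFunction⟩, ⟨_, hfix⟩,
    FlowComplexity.meanDim_shiftFlow,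
    FlowComplexity.topEntropy_eq_zero _ hfix
      (FlowComplexity.mostlyNear_slowFlow _ _ hw hw1 hslow)⟩
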